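/- Let $m\ge 2$. For $i=1,2$ let $Y_i$ be a Young diagram with fewer than $m$ rows, let $\lambda_i\in\mathbb R$, $z_i\in\mathbb Z$, let $(V_i,\rho_{D,i})$ be the representation of $GL(m,\mathbb R)$ corresponding to $Y_i$ (the image of the Young symmetrizer of $Y_i$ in the tensors over $\mathbb R^m$), and put $\rho_i(A)u=|\det A|^{\lambda_i}(\det A)^{z_i}\rho_{D,i}(A)u$. For $k\in\mathbb N$ let $S^k=S^k\mathbb R^m\otimes V_1^*\otimes V_2$ with its natural representation $\rho$ of $GL(m,\mathbb R)$ and differential $\rho_*$, let $\mathcal S^k=C^\infty(\mathbb R^m,S^k)$, and let $\mathcal S(\mathbb R^m)=\bigoplus_{k\ge 0}\mathcal S^k$ be the space of symbols, on which a vector field $X$ acts by $(L_XT)(x)=(X.T)(x)-\rho_*(D_xX)T(x)$. To $h=\begin{pmatrix}A&v\\ \xi&a\end{pmatrix}\in sl(m+1,\mathbb R)$ associate the vector field $X^h_x=-v-(A-a\,\mathrm{Id})x+\xi(x)x$ on $\mathbb R^m$. Let $C=\sum_i L_{X^{b_i}}\circ L_{X^{b_i^*}}$ be the Casimir operator of $(\mathcal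 S(\mathbb R^m),L)$, where $(b_i)$ is any basis of $sl(m+1,\mathbb R)$ and $(b_i^*)$ is the dual basis with respect to the Killing form. Then the space $\mathcal S(\mathbb R^m)$ is the direct sum of the eigenspaces of $C$. Precisely: (a) For every $k$ the $sl(m,\mathbb R)$-module $S^k$ is a direct sum of finitely many irreducible submodules, and there are unique real numbers $a_1,a_2$ with $(\rho_i)_*(\mathrm{Id})=a_i\,\mathrm{Id}_{V_i}$. Put $\delta=\frac1m(a_1-a_2)$. (b) For every choice, for each $k$, of a decomposition $S^k=\bigoplus_{s=1}^{n_k}I_{k,s}$ into irreducible $sl(m,\mathbb R)$-submodules, $\mathcal S(\mathbb R^m)$ is the direct sum of the spaces $E_{k,s}=C^\infty(\mathbb R^m,I_{k,s})$, each complexification $I_{k,s}\otimes\mathbb C$ has a unique highest weight $\mu_{I_{k,s}}$ as a representation of $sl(m,\mathbb C)$ (for the Cartan subalgebra of diagonal traceless matrices and the simple roots $\delta_i-\delta_{i+1}$, where $\delta_i(\mathrm{diag}(c_1,\dots,c_m))=c_i$), and the restriction of $C$ to $E_{k,s}$ equals $\alpha_{k,s}\,\mathrm{Id}$ with the real number $$\alpha_{k,s}=\frac1{2m}(m\delta-k)(m(\delta-1)-k)+\frac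 m{m+1}\bigl(\mu_{I_{k,s}},\mu_{I_{k,s}}+2\rho_S\bigr).$$ Here $\rho_S=\sum_{i=1}^m(m-i)\delta_i$ is half the sum of the positive roots and $(\,,\,)$ is the bilinear form induced on the dual of the Cartan subalgebra by the Killing form of $sl(m,\mathbb C)$. -/

import Mathlib

noncomputable section

namespace ProjectiveSymbols

open LieAlgebra.SpecialLinear
open scoped Matrix ComplexOrder ContDiff DirectSum TensorProduct

/-! ### Tensors and Young diagrams -/

/-- The space `ℝ^m`. -/
abbrev Vec (m : ℕ) : Type := Fin m → ℝ

/-- The algebra of endomorphisms of `ℝ^m`; it is the Lie algebra `gl(m, ℝ)`. -/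
abbrev Endo (m : ℕ) : Type := Vec m →L[ℝ] Vec m

/-- The group `GL(m, ℝ)`. -/
abbrev GLin (m : ℕ) : Type := (Endo m)ˣ

/-- The tensor product `(ℝ^m)^{⊗ ι} ⊗ W`, realised as the space of `W`-valued multilinear
functions of covectors `ξ_i ∈ (ℝ^m)^*`, `i ∈ ι`: the decomposable tensor `(⊗ x_i) ⊗ w` is the
function `ξ ↦ (∏ i, ξ_i (x_i)) • w`. -/
def Tensors (m : ℕ) (ι W : Type*) [Fintype ι] [NormedAddCommGroup W] [NormedSpace ℝ W] :
    Type _ :=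
  ContinuousMultilinearMap ℝ (fun _ : ι => Vec m →L[ℝ] ℝ) W

section Tensors

variable {m : ℕ} {ι W : Type*} [Fintype ι] [NormedAddCommGroup W] [NormedSpace ℝ W]

instance : NormedAddCommGroup (Tensors m ι W) :=
  inferInstanceAs (NormedAddCommGroup
    (ContinuousMultilinearMap ℝ (fun _ : ι => Vec m →L[ℝ] ℝ) W))

instance : NormedSpace ℝ (Tensors m ι W) :=
  inferInstanceAs (NormedSpace ℝ (ContinuousMultilinearMap ℝ (fun _ : ι => Vec m →L[ℝ] ℝ) W))

/-- The value of a tensor, seen as a multilinear function, on a family of covectors. -/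
def Tensors.eval (T : Tensors m ι W) (ξ : ι → Vec m →L[ℝ] ℝ) : W :=
  (show ContinuousMultilinearMap ℝ (fun _ : ι => Vec m →L[ℝ] ℝ) W from T) ξ

theorem Tensors.ext {T U : Tensors m ι W} (h : ∀ ξ, T.eval ξ = U.eval ξ) : T = U :=
  ContinuousMultilinearMap.ext h

/-- The natural action `a ⊗ ⋯ ⊗ a ⊗ id` on tensors: `x_1 ⊗ ⋯ ⊗ x_k ⊗ w` is sent to
`a x_1 ⊗ ⋯ ⊗ a x_k ⊗ w`. -/
def tensorAct (ι W : Type*) [Fintype ι] [NormedAddCommGroup W] [NormedSpace ℝ W]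
    (a : Endo m) : Tensors m ι W →L[ℝ] Tensors m ι W :=
  (ContinuousMultilinearMap.compContinuousLinearMapL
    (fun _ : ι => ContinuousLinearMap.precomp ℝ a) :
      ContinuousMultilinearMap ℝ (fun _ : ι => Vec m →L[ℝ] ℝ) W →L[ℝ]
        ContinuousMultilinearMap ℝ (fun _ : ι => Vec m →L[ℝ] ℝ) W)

theorem tensorAct_eval (a : Endo m) (T : Tensors m ι W) (ξ : ι → Vec m →L[ℝ] ℝ) :
    (tensorAct ι W a T).eval ξ = T.eval (fun i => (ξ i).comp a) := rfl

/-- The action of a permutation of the factors on tensors. -/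
def permAct (σ : Equiv.Perm ι) : Tensors m ι W →ₗ[ℝ] Tensors m ι W where
  toFun T := ContinuousMultilinearMap.domDomCongr (M₂ := Vec m →L[ℝ] ℝ) (M₃ := W) σ T
  map_add' _ _ := rfl
  map_smul' _ _ := rfl

theorem permAct_eval (σ : Equiv.Perm ι) (T : Tensors m ι W) (ξ : ι → Vec m →L[ℝ] ℝ) :
    (permAct σ T).eval ξ = T.eval (fun i => ξ (σ i)) := rfl

theorem tensorAct_permAct (a : Endo m) (σ : Equiv.Perm ι) (T : Tensors m ι W) :
    tensorAct ι W a (permAct σ T) = permAct σ (tensorAct ι W a T) := rfl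

end Tensors

/-- The permutations of the cells of a Young diagram that preserve each row. -/
def rowGroup (Y : YoungDiagram) : Finset (Equiv.Perm Y.cells) :=
  Finset.univ.filter fun p => ∀ c : Y.cells, (p c).1.1 = c.1.1

/-- The permutations of the cells of a Young diagram that preserve each column. -/
def colGroup (Y : YoungDiagram) : Finset (Equiv.Perm Y.cells) :=
  Finset.univ.filter fun q => ∀ c : Y.cells, (q c).1.2 = c.1.2

/-- The Young symmetrizer: antisymmetrize along the columns, then symmetrize along the rows. -/
def youngSymmetrizer (m : ℕ) (Y : YoungDiagram) :
    Tensors m Y.cells ℝ →ₗ[ℝ] Tensors m Y.cells ℝ :=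
  ∑ p ∈ rowGroup Y, ∑ q ∈ colGroup Y,
    ((Equiv.Perm.sign q : ℤ) : ℝ) • (permAct p ∘ₗ permAct q)

/-- The image of the Young symmetrizer in the tensors indexed by the cells of `Y`. -/
def youngModule (m : ℕ) (Y : YoungDiagram) : Submodule ℝ (Tensors m Y.cells ℝ) :=
  LinearMap.range (youngSymmetrizer m Y)

/-- The space `V` of the representation `ρ_D` of `GL(m, ℝ)` corresponding to the Young
diagram `Y`: the image of the Young symmetrizer, as a normed space (the norm only serves
to speak of derivatives). -/
def YoungSpace (m : ℕ) (Y : YoungDiagram) : Type := youngModule m Y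

instance (m : ℕ) (Y : YoungDiagram) : NormedAddCommGroup (YoungSpace m Y) :=
  inferInstanceAs (NormedAddCommGroup (youngModule m Y))

instance (m : ℕ) (Y : YoungDiagram) : NormedSpace ℝ (YoungSpace m Y) :=
  inferInstanceAs (NormedSpace ℝ (youngModule m Y))

theorem tensorAct_mem_youngModule {m : ℕ} {Y : YoungDiagram} (a : Endo m)
    {T : Tensors m Y.cells ℝ} (hT : T ∈ youngModule m Y) :
    tensorAct Y.cells ℝ a T ∈ youngModule m Y := by
  obtain ⟨U, rfl⟩ := hT
  refine ⟨tensorAct Y.cells ℝ a U, ?_⟩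
  simp only [youngSymmetrizer, LinearMap.sum_apply, LinearMap.smul_apply, LinearMap.comp_apply,
    map_sum, map_smul, tensorAct_permAct]

/-- The map `ρ_D(a)`, the restriction of `a ⊗ ⋯ ⊗ a` to the image of the Young symmetrizer. -/
def youngAct {m : ℕ} (Y : YoungDiagram) (a : Endo m) : YoungSpace m Y →L[ℝ] YoungSpace m Y :=
  (((tensorAct Y.cells ℝ a).comp (youngModule m Y).subtypeL).codRestrict (youngModule m Y)
    fun T => tensorAct_mem_youngModule a T.2 : youngModule m Y →L[ℝ] youngModule m Y)

/-- The representation `ρ(a) u = |det a|^lam (det a)^z ρ_D(a) u` of `GL(m, ℝ)` on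
`YoungSpace m Y`. -/
def youngRep (m : ℕ) (Y : YoungDiagram) (lam : ℝ) (z : ℤ) :
    GLin m →* (YoungSpace m Y →L[ℝ] YoungSpace m Y) where
  toFun a := (|(a : Endo m).det| ^ lam * (a : Endo m).det ^ z) • youngAct Y (a : Endo m)
  map_one' := by
    have h : youngAct Y (1 : Endo m) = 1 := rfl
    have hd : (1 : Endo m).det = 1 := by simp [ContinuousLinearMap.det]
    simp [h, hd]
  map_mul' a b := by
    have h : youngAct Y (a.val * b.val) = youngAct Y a.val * youngAct Y b.val :=
      rfl
    have hd : (a.val * b.val).det = a.val.det * b.val.det := by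
      simp [ContinuousLinearMap.det]
    rw [Units.val_mul, h, hd, abs_mul, Real.mul_rpow (abs_nonneg _) (abs_nonneg _), mul_zpow,
      smul_mul_smul_comm]
    congr 1
    ring

/-! ### Representations of `GL(m, ℝ)` and their differentials -/

/-- The differential `ρ_* : gl(m, ℝ) → gl(V)` of a representation `ρ` of `GL(m, ℝ)`, that is,
the derivative of `ρ` at the identity (`GL(m, ℝ)` is open in `gl(m, ℝ)`, and the values of the
extension of `ρ` by zero outside of `GL(m, ℝ)` do not matter). -/
def diffRep {m : ℕ} {V : Type*} [NormedAddCommGroup V] [NormedSpace ℝ V]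
    (ρ : GLin m →* (V →L[ℝ] V)) : Endo m →L[ℝ] (V →L[ℝ] V) :=
  fderiv ℝ (Function.extend (Units.val : GLin m → Endo m) ρ 0) 1

/-- A real matrix as an element of `gl(m, ℝ)`. -/
def ofMatrix {m : ℕ} (A : Matrix (Fin m) (Fin m) ℝ) : Endo m :=
  LinearMap.toContinuousLinearMap (Matrix.toLin' A)

section SlModules

variable {m : ℕ} {V : Type*} [NormedAddCommGroup V] [NormedSpace ℝ V]

/-- Invariance of a subspace under `sl(m, ℝ)`. -/
def IsSlInvariant (ρ : GLin m →* (V →L[ℝ] V)) (N : Submodule ℝ V) : Prop :=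
  ∀ A : sl (Fin m) ℝ, ∀ v ∈ N, diffRep ρ (ofMatrix A.1) v ∈ N

/-- `N` is an irreducible `sl(m, ℝ)`-subrepresentation. -/
def IsSlIrreducible (ρ : GLin m →* (V →L[ℝ] V)) (N : Submodule ℝ V) : Prop :=
  IsSlInvariant ρ N ∧ N ≠ ⊥ ∧ ∀ N' : Submodule ℝ V, IsSlInvariant ρ N' → N' ≤ N → N' = ⊥ ∨ N' = N

/-- The subspaces `I s` are irreducible under `sl(m, ℝ)` and `V` is their direct sum. -/
def IsSlDecomposition (ρ : GLin m →* (V →L[ℝ] V)) {n : ℕ} (I : Fin n → Submodule ℝ V) : Prop :=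
  DirectSum.IsInternal I ∧ ∀ s, IsSlIrreducible ρ (I s)

/-- The action of a complex matrix `A + i B` on the complexification `ℂ ⊗ V`, namely
`ρ_*(A) + i ρ_*(B)`. -/
def complexAct (ρ : GLin m →* (V →L[ℝ] V)) (Z : Matrix (Fin m) (Fin m) ℂ) :
    Module.End ℂ (ℂ ⊗[ℝ] V) :=
  (diffRep ρ (ofMatrix (Z.map Complex.re)) : V →ₗ[ℝ] V).baseChange ℂ +
    Complex.I • (diffRep ρ (ofMatrix (Z.map Complex.im)) : V →ₗ[ℝ] V).baseChange ℂ

end SlModules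

/-! ### The Killing form of `sl`, weights -/

/-- The Killing form of `sl(n)` is `(A, B) ↦ 2 n tr(A B)`. -/
theorem slKillingForm_apply {K ι : Type*} [Field K] [Fintype ι] [DecidableEq ι]
    (A B : sl ι K) :
    killingForm K (sl ι K) A B = 2 * (Fintype.card ι : K) * (A.1 * B.1).trace := by
  obtain ⟨a, ha⟩ := A
  obtain ⟨b, hb⟩ := B
  have hA : ∑ i, a i i = 0 := ha
  have hB : ∑ i, b i i = 0 := hb
  let f : Matrix ι ι K →ₗ[K] Matrix ι ι K :=
    (LinearMap.mulLeft K a - LinearMap.mulRight K a) ∘ₗ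
      (LinearMap.mulLeft K b - LinearMap.mulRight K b)
  have hmem : ∀ X, f X ∈ LinearMap.ker (Matrix.traceLinearMap ι K K) := by
    intro X
    simp only [f, LinearMap.mem_ker, LinearMap.comp_apply, LinearMap.sub_apply,
      LinearMap.mulLeft_apply, LinearMap.mulRight_apply, Matrix.traceLinearMap_apply,
      Matrix.trace_sub]
    rw [Matrix.trace_mul_comm a, sub_self]
  have h1 : killingForm K (sl ι K) ⟨a, ha⟩ ⟨b, hb⟩ = LinearMap.trace K _ f := by
    rw [← LinearMap.trace_restrict_eq_of_forall_mem _ f hmem, killingForm_apply_apply]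
    rfl
  rw [h1, LinearMap.trace_eq_matrix_trace K (Matrix.stdBasis K ι ι), Matrix.trace,
    Fintype.sum_prod_type]
  have h2 : ∀ i j, (LinearMap.toMatrix (Matrix.stdBasis K ι ι) (Matrix.stdBasis K ι ι) f).diag
      (i, j) = (a * b) i i - a i i * b j j - b i i * a j j + (b * a) j j := by
    intro i j
    rw [Matrix.diag_apply, LinearMap.toMatrix_apply, Matrix.stdBasis_eq_single]
    have : ∀ M : Matrix ι ι K, (Matrix.stdBasis K ι ι).repr M (i, j) = M i j := fun M => rfl
    rw [this]
    simp only [f, LinearMap.comp_apply, LinearMap.sub_apply, LinearMap.mulLeft_apply,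
      LinearMap.mulRight_apply, mul_sub, sub_mul, Matrix.sub_apply]
    have e1 : (a * (b * Matrix.single i j (1 : K))) i j = (a * b) i i := by
      rw [← mul_assoc, Matrix.mul_single_apply_same, mul_one]
    have e2 : (a * (Matrix.single i j (1 : K) * b)) i j = a i i * b j j := by
      rw [← mul_assoc, Matrix.mul_apply, Finset.sum_eq_single j] <;> simp +contextual
    have e3 : (b * Matrix.single i j (1 : K) * a) i j = b i i * a j j := by
      rw [Matrix.mul_apply, Finset.sum_eq_single j] <;> simp +contextual
    have e4 : (Matrix.single i j (1 : K) * b * a) i j = (b * a) j j := by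
      rw [mul_assoc, Matrix.single_mul_apply_same, one_mul]
    rw [e1, e2, e3, e4]; ring
  have h3 : ∑ i, (a * b) i i = (a * b).trace := rfl
  have h4 : ∑ i, (b * a) i i = (a * b).trace := Matrix.trace_mul_comm _ _
  simp only [h2, Finset.sum_add_distrib, Finset.sum_sub_distrib, ← Finset.mul_sum, Finset.sum_const,
    Finset.card_univ, nsmul_eq_mul, hA, hB, h4, h3, ← Finset.sum_mul]
  ring

/-- The conjugate transpose of a trace-free matrix (used to prove nondegeneracy). -/
def slStar {K ι : Type*} [RCLike K] [Fintype ι] [DecidableEq ι] (A : sl ι K) : sl ι K :=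
  ⟨A.1ᴴ, by
    have hA : A.1.trace = 0 := A.2
    change (A.1ᴴ).trace = 0
    rw [Matrix.trace_conjTranspose, hA, star_zero]⟩

theorem eq_zero_of_killingForm_slStar {K ι : Type*} [RCLike K] [Fintype ι] [DecidableEq ι]
    (A : sl ι K) (h : killingForm K (sl ι K) A (slStar A) = 0) : A = 0 := by
  rw [slKillingForm_apply] at h
  rcases isEmpty_or_nonempty ι with hι | hι
  · exact Subtype.ext (Subsingleton.elim _ _)
  · have hc : (2 * (Fintype.card ι : K)) ≠ 0 := by simp
    have h2 := (mul_eq_zero.1 h).resolve_left hc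
    exact Subtype.ext (Matrix.trace_mul_conjTranspose_self_eq_zero_iff.1 h2)

theorem slKillingForm_nondegenerate (K ι : Type*) [RCLike K] [Fintype ι]
    [DecidableEq ι] : (killingForm K (sl ι K)).Nondegenerate :=
  ((LieModule.traceForm_isSymm K (sl ι K) (sl ι K)).isRefl.nondegenerate_iff_separatingLeft).2
    fun A hA => eq_zero_of_killingForm_slStar A (hA _)

/-- The usual Cartan subalgebra of `sl(m, ℂ)`: the diagonal trace-free matrices. -/
def cartan (m : ℕ) : Submodule ℂ (sl (Fin m) ℂ) where
  carrier := {H | H.1.IsDiag}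
  add_mem' h₁ h₂ := Matrix.IsDiag.add h₁ h₂
  zero_mem' := Matrix.isDiag_zero
  smul_mem' c _ h := Matrix.IsDiag.smul c h

/-- The restriction of the Killing form of `sl(m, ℂ)` to the Cartan subalgebra. -/
def cartanKilling (m : ℕ) : LinearMap.BilinForm ℂ (cartan m) :=
  (killingForm ℂ (sl (Fin m) ℂ)).restrict (cartan m)

theorem cartanKilling_nondegenerate (m : ℕ) : (cartanKilling m).Nondegenerate := by
  have hs : (cartanKilling m).IsSymm :=
    ⟨fun x y => (LieModule.traceForm_isSymm ℂ (sl (Fin m) ℂ) (sl (Fin m) ℂ)).eq x.1 y.1⟩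
  refine (hs.isRefl.nondegenerate_iff_separatingLeft).2 fun H hH => Subtype.ext ?_
  exact eq_zero_of_killingForm_slStar H.1
    (hH ⟨slStar H.1, Matrix.IsDiag.conjTranspose H.2⟩)

/-- The bilinear form `(μ, ν)` on the dual of the Cartan subalgebra that is induced by the Killing
form of `sl(m, ℂ)`: `(μ, ν) = B(t_μ, t_ν)`, where `B(t_μ, H) = μ(H)` for all `H`. -/
def weightForm {m : ℕ} (μ ν : Module.Dual ℂ (cartan m)) : ℂ :=
  cartanKilling m (((cartanKilling m).toDual (cartanKilling_nondegenerate m)).symm μ)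
    (((cartanKilling m).toDual (cartanKilling_nondegenerate m)).symm ν)

/-- The linear form `δ_i (diag(a_1, …, a_m)) = a_i`. -/
def coordWeight {m : ℕ} (i : Fin m) : Module.Dual ℂ (cartan m) where
  toFun H := H.1.1 i i
  map_add' _ _ := rfl
  map_smul' _ _ := rfl

/-- The Weyl vector `ρ_S = ∑ i, (m - i) δ_i`, with `i` running from `1` to `m`. -/
def weylVector (m : ℕ) : Module.Dual ℂ (cartan m) :=
  ∑ i : Fin m, ((m : ℂ) - ((i : ℕ) + 1)) • coordWeight i

/-- `μ` is a highest weight of the complexification of the `sl(m, ℝ)`-invariant subspace `N`: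
there is a nonzero vector of weight `μ` in `N ⊗ ℂ` that is annihilated by the root vectors
`E_{ij}`, `i < j`, of the positive roots `δ_i - δ_j`. -/
def IsHighestWeight {m : ℕ} {V : Type*} [NormedAddCommGroup V] [NormedSpace ℝ V]
    (ρ : GLin m →* (V →L[ℝ] V)) (N : Submodule ℝ V) (μ : Module.Dual ℂ (cartan m)) : Prop :=
  ∃ v ∈ N.baseChange ℂ, v ≠ 0 ∧ (∀ H : cartan m, complexAct ρ H.1.1 v = μ H • v) ∧
    ∀ i j : Fin m, i < j → complexAct ρ (Matrix.single i j 1) v = 0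

/-! ### Symbols -/

section Symbols

variable {m : ℕ} {V₁ V₂ : Type*} [NormedAddCommGroup V₁] [NormedSpace ℝ V₁]
  [NormedAddCommGroup V₂] [NormedSpace ℝ V₂]

/-- The symmetric tensors with coefficients in `V₁^* ⊗ V₂ = Hom(V₁, V₂)`. -/
def symTensors (m : ℕ) (V₁ V₂ : Type*) [NormedAddCommGroup V₁] [NormedSpace ℝ V₁]
    [NormedAddCommGroup V₂] [NormedSpace ℝ V₂] (k : ℕ) :
    Submodule ℝ (Tensors m (Fin k) (V₁ →L[ℝ] V₂)) where
  carrier := {T | ∀ σ : Equiv.Perm (Fin k), permAct σ T = T}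
  add_mem' h₁ h₂ σ := by rw [map_add, h₁ σ, h₂ σ]
  zero_mem' σ := map_zero _
  smul_mem' c T h σ := by rw [map_smul, h σ]

/-- The space `S^k ℝ^m ⊗ V₁^* ⊗ V₂`, as a normed space. -/
def SymTensors (m : ℕ) (V₁ V₂ : Type*) [NormedAddCommGroup V₁] [NormedSpace ℝ V₁]
    [NormedAddCommGroup V₂] [NormedSpace ℝ V₂] (k : ℕ) : Type _ :=
  symTensors m V₁ V₂ k

instance (m : ℕ) (V₁ V₂ : Type*) [NormedAddCommGroup V₁] [NormedSpace ℝ V₁]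
    [NormedAddCommGroup V₂] [NormedSpace ℝ V₂] (k : ℕ) :
    NormedAddCommGroup (SymTensors m V₁ V₂ k) :=
  inferInstanceAs (NormedAddCommGroup (symTensors m V₁ V₂ k))

instance (m : ℕ) (V₁ V₂ : Type*) [NormedAddCommGroup V₁] [NormedSpace ℝ V₁]
    [NormedAddCommGroup V₂] [NormedSpace ℝ V₂] (k : ℕ) :
    NormedSpace ℝ (SymTensors m V₁ V₂ k) :=
  inferInstanceAs (NormedSpace ℝ (symTensors m V₁ V₂ k))

/-- The action `A ↦ ρ₂(a) ∘ A ∘ ρ₁(a)⁻¹` of `GL(m, ℝ)` on `V₁^* ⊗ V₂ = Hom(V₁, V₂)`. -/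
def homAct (ρ₁ : GLin m →* (V₁ →L[ℝ] V₁)) (ρ₂ : GLin m →* (V₂ →L[ℝ] V₂)) (a : GLin m) :
    (V₁ →L[ℝ] V₂) →L[ℝ] (V₁ →L[ℝ] V₂) :=
  (ContinuousLinearMap.precomp V₂ (ρ₁ a⁻¹)).comp (ContinuousLinearMap.postcomp V₁ (ρ₂ a))

/-- The natural action of `GL(m, ℝ)` on `(ℝ^m)^{⊗ k} ⊗ V₁^* ⊗ V₂`. -/
def tensorHomAct (ρ₁ : GLin m →* (V₁ →L[ℝ] V₁)) (ρ₂ : GLin m →* (V₂ →L[ℝ] V₂)) (k : ℕ)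
    (a : GLin m) : Tensors m (Fin k) (V₁ →L[ℝ] V₂) →L[ℝ] Tensors m (Fin k) (V₁ →L[ℝ] V₂) :=
  (ContinuousLinearMap.compContinuousMultilinearMapL ℝ (fun _ : Fin k => Vec m →L[ℝ] ℝ)
    (V₁ →L[ℝ] V₂) (V₁ →L[ℝ] V₂) (homAct ρ₁ ρ₂ a) :
      Tensors m (Fin k) (V₁ →L[ℝ] V₂) →L[ℝ] Tensors m (Fin k) (V₁ →L[ℝ] V₂)).comp
    (tensorAct (Fin k) (V₁ →L[ℝ] V₂) (a : Endo m))

theorem tensorHomAct_eval (ρ₁ : GLin m →* (V₁ →L[ℝ] V₁)) (ρ₂ : GLin m →* (V₂ →L[ℝ] V₂)) (k : ℕ)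
    (a : GLin m) (T : Tensors m (Fin k) (V₁ →L[ℝ] V₂)) (ξ : Fin k → Vec m →L[ℝ] ℝ) :
    (tensorHomAct ρ₁ ρ₂ k a T).eval ξ
      = (ρ₂ a).comp ((T.eval fun i => (ξ i).comp (a : Endo m)).comp (ρ₁ a⁻¹)) := rfl

/-- The restriction of `tensorHomAct` to symmetric tensors. -/
def symbolAct (ρ₁ : GLin m →* (V₁ →L[ℝ] V₁)) (ρ₂ : GLin m →* (V₂ →L[ℝ] V₂)) (k : ℕ)
    (a : GLin m) : SymTensors m V₁ V₂ k →L[ℝ] SymTensors m V₁ V₂ k :=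
  (((tensorHomAct ρ₁ ρ₂ k a).comp (symTensors m V₁ V₂ k).subtypeL).codRestrict
    (symTensors m V₁ V₂ k) fun T σ => congrArg (tensorHomAct ρ₁ ρ₂ k a) (T.2 σ) :
      symTensors m V₁ V₂ k →L[ℝ] symTensors m V₁ V₂ k)

/-- The natural representation `ρ` of `GL(m, ℝ)` on `S^k ℝ^m ⊗ V₁^* ⊗ V₂`. -/
def symbolRep (ρ₁ : GLin m →* (V₁ →L[ℝ] V₁)) (ρ₂ : GLin m →* (V₂ →L[ℝ] V₂)) (k : ℕ) :
    GLin m →* (SymTensors m V₁ V₂ k →L[ℝ] SymTensors m V₁ V₂ k) where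
  toFun a := symbolAct ρ₁ ρ₂ k a
  map_one' := by
    refine ContinuousLinearMap.ext fun T => Subtype.ext ?_
    refine Tensors.ext fun ξ => ContinuousLinearMap.ext fun u => ?_
    change (ρ₂ 1) ((T.1.eval fun i => (ξ i).comp ((1 : GLin m) : Endo m)) ((ρ₁ 1⁻¹) u)) = T.1.eval ξ u
    rw [inv_one, map_one, map_one]
    rfl
  map_mul' a b := by
    refine ContinuousLinearMap.ext fun T => Subtype.ext ?_
    refine Tensors.ext fun ξ => ContinuousLinearMap.ext fun u => ?_
    change (ρ₂ (a * b)) ((T.1.eval fun i => (ξ i).comp ((a * b : GLin m) : Endo m))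
      ((ρ₁ (a * b)⁻¹) u)) = (ρ₂ a) ((ρ₂ b) ((T.1.eval fun i => ((ξ i).comp (a : Endo m)).comp
        (b : Endo m)) ((ρ₁ b⁻¹) ((ρ₁ a⁻¹) u))))
    rw [mul_inv_rev, map_mul, map_mul]
    rfl

/-- The space `𝒮^k(ℝ^m) = C^∞(ℝ^m, S^k ℝ^m ⊗ V₁^* ⊗ V₂)` of symbols of degree `k`. -/
def SymbolsDeg (m : ℕ) (V₁ V₂ : Type*) [NormedAddCommGroup V₁] [NormedSpace ℝ V₁]
    [NormedAddCommGroup V₂] [NormedSpace ℝ V₂] (k : ℕ) :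
    Submodule ℝ (Vec m → SymTensors m V₁ V₂ k) where
  carrier := {T | ContDiff ℝ ∞ T}
  add_mem' {T U} hT hU := by
    change ContDiff ℝ ∞ T at hT
    change ContDiff ℝ ∞ U at hU
    exact hT.add hU
  zero_mem' := by
    change ContDiff ℝ ∞ fun _ : Vec m => (0 : SymTensors m V₁ V₂ k)
    exact contDiff_const
  smul_mem' c T hT := by
    change ContDiff ℝ ∞ T at hT
    exact hT.const_smul c

/-- The space of symbols `𝒮(ℝ^m) = ⨁ k, 𝒮^k(ℝ^m)`. -/
def Symbols (m : ℕ) (V₁ V₂ : Type*) [NormedAddCommGroup V₁] [NormedSpace ℝ V₁]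
    [NormedAddCommGroup V₂] [NormedSpace ℝ V₂] : Type _ :=
  ⨁ k : ℕ, SymbolsDeg m V₁ V₂ k

instance : AddCommGroup (Symbols m V₁ V₂) :=
  inferInstanceAs (AddCommGroup (⨁ k : ℕ, SymbolsDeg m V₁ V₂ k))

instance : Module ℝ (Symbols m V₁ V₂) :=
  inferInstanceAs (Module ℝ (⨁ k : ℕ, SymbolsDeg m V₁ V₂ k))

/-- The inclusion of `𝒮^k(ℝ^m)` in `𝒮(ℝ^m)`. -/
def inclDeg (m : ℕ) (V₁ V₂ : Type*) [NormedAddCommGroup V₁] [NormedSpace ℝ V₁]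
    [NormedAddCommGroup V₂] [NormedSpace ℝ V₂] (k : ℕ) :
    SymbolsDeg m V₁ V₂ k →ₗ[ℝ] Symbols m V₁ V₂ :=
  DirectSum.lof ℝ ℕ (fun k => SymbolsDeg m V₁ V₂ k) k

/-- The Lie derivative `(L_X T)(x) = (X.T)(x) - ρ_*(D_x X) T(x)` of symbols of degree `k` along
a smooth vector field `X` on `ℝ^m`. -/
def lieDerivDeg (ρ₁ : GLin m →* (V₁ →L[ℝ] V₁)) (ρ₂ : GLin m →* (V₂ →L[ℝ] V₂))
    (X : Vec m → Vec m) (hX : ContDiff ℝ ∞ X) (k : ℕ) :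
    SymbolsDeg m V₁ V₂ k →ₗ[ℝ] SymbolsDeg m V₁ V₂ k where
  toFun T := ⟨fun x => fderiv ℝ T.1 x (X x) - diffRep (symbolRep ρ₁ ρ₂ k) (fderiv ℝ X x) (T.1 x),
    by
      have hT : ContDiff ℝ ∞ T.1 := T.2
      have h1 : ContDiff ℝ ∞ (fun x => fderiv ℝ T.1 x (X x)) :=
        (hT.fderiv_right (m := ∞) le_rfl).clm_apply hX
      have h2 : ContDiff ℝ ∞ (fun x => diffRep (symbolRep ρ₁ ρ₂ k) (fderiv ℝ X x) (T.1 x)) :=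
        ((diffRep (symbolRep ρ₁ ρ₂ k)).contDiff.comp
          (hX.fderiv_right (m := ∞) le_rfl)).clm_apply hT
      exact h1.sub h2⟩
  map_add' T U := by
    have hT : ContDiff ℝ ∞ T.1 := T.2
    have hU : ContDiff ℝ ∞ U.1 := U.2
    refine Subtype.ext (funext fun x => ?_)
    have h : fderiv ℝ (T.1 + U.1) x = fderiv ℝ T.1 x + fderiv ℝ U.1 x :=
      fderiv_add (hT.differentiable (by simp) x) (hU.differentiable (by simp) x)
    change fderiv ℝ (T.1 + U.1) x (X x) - diffRep (symbolRep ρ₁ ρ₂ k) (fderiv ℝ X x)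
      (T.1 x + U.1 x) = (fderiv ℝ T.1 x (X x) - diffRep (symbolRep ρ₁ ρ₂ k) (fderiv ℝ X x) (T.1 x))
        + (fderiv ℝ U.1 x (X x) - diffRep (symbolRep ρ₁ ρ₂ k) (fderiv ℝ X x) (U.1 x))
    rw [h, map_add, add_apply]
    abel
  map_smul' c T := by
    have hT : ContDiff ℝ ∞ T.1 := T.2
    refine Subtype.ext (funext fun x => ?_)
    have h : fderiv ℝ (c • T.1) x = c • fderiv ℝ T.1 x :=
      fderiv_const_smul (hT.differentiable (by simp) x) c
    change fderiv ℝ (c • T.1) x (X x) - diffRep (symbolRep ρ₁ ρ₂ k) (fderiv ℝ X x)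
      (c • T.1 x) = c • (fderiv ℝ T.1 x (X x)
        - diffRep (symbolRep ρ₁ ρ₂ k) (fderiv ℝ X x) (T.1 x))
    rw [h, map_smul, smul_apply, smul_sub]

/-- The Lie derivative of symbols along a smooth vector field. -/
def lieDeriv (ρ₁ : GLin m →* (V₁ →L[ℝ] V₁)) (ρ₂ : GLin m →* (V₂ →L[ℝ] V₂))
    (X : Vec m → Vec m) (hX : ContDiff ℝ ∞ X) : Module.End ℝ (Symbols m V₁ V₂) :=
  (DirectSum.lmap fun k => lieDerivDeg ρ₁ ρ₂ X hX k :
    (⨁ k : ℕ, SymbolsDeg m V₁ V₂ k) →ₗ[ℝ] ⨁ k : ℕ, SymbolsDeg m V₁ V₂ k)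

/-! ### The projective algebra of vector fields and its Casimir operator -/

/-- The vector field `X^h` on `ℝ^m` of `h = (A, v; ξ, a) ∈ sl(m + 1, ℝ)` (block form). Under
`h ↦ (v, A - a Id, ξ) ∈ ℝ^m ⊕ gl(m, ℝ) ⊕ ℝ^{m*}` it is `-v` for `v ∈ ℝ^m`, `-[B, x] = - B x` for
`B ∈ gl(m, ℝ)` and `-1/2 [[ξ, x], x] = ξ(x) x` for `ξ ∈ ℝ^{m*}`. -/
def projField (h : sl (Fin m ⊕ Unit) ℝ) (x : Vec m) : Vec m :=
  -(fun i => h.1 (Sum.inl i) (Sum.inr ()))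
    - (h.1.toBlocks₁₁ - h.1 (Sum.inr ()) (Sum.inr ()) • (1 : Matrix (Fin m) (Fin m) ℝ)) *ᵥ x
    + (∑ j, h.1 (Sum.inr ()) (Sum.inl j) * x j) • x

theorem contDiff_projField (h : sl (Fin m ⊕ Unit) ℝ) : ContDiff ℝ ∞ (projField h) := by
  have h1 : ∀ B : Matrix (Fin m) (Fin m) ℝ, ContDiff ℝ ∞ (fun x : Vec m => B *ᵥ x) := fun B =>
    (LinearMap.toContinuousLinearMap (Matrix.mulVecLin B)).contDiff
  unfold projField
  have h2 : ContDiff ℝ ∞ (fun x : Vec m => ∑ j, h.1 (Sum.inr ()) (Sum.inl j) * x j) := by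
    fun_prop
  exact (contDiff_const.sub (h1 _)).add (h2.smul (contDiff_id (𝕜 := ℝ) (E := Vec m)))

/-- The action `h ↦ L_{X^h}` of `sl(m + 1, ℝ)` on symbols. -/
def projAct (ρ₁ : GLin m →* (V₁ →L[ℝ] V₁)) (ρ₂ : GLin m →* (V₂ →L[ℝ] V₂))
    (h : sl (Fin m ⊕ Unit) ℝ) : Module.End ℝ (Symbols m V₁ V₂) :=
  lieDeriv ρ₁ ρ₂ (projField h) (contDiff_projField h)

/-- The Casimir operator `C = ∑ i, L_{X^{b_i}} ∘ L_{X^{b_i^*}}` of `(𝒮, L)`, computed in a basis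
`b` of `sl(m + 1, ℝ)` and its dual basis `b^*` with respect to the Killing form. -/
def casimir (ρ₁ : GLin m →* (V₁ →L[ℝ] V₁)) (ρ₂ : GLin m →* (V₂ →L[ℝ] V₂))
    {ι : Type*} [Fintype ι] [DecidableEq ι] (b : Module.Basis ι ℝ (sl (Fin m ⊕ Unit) ℝ)) :
    Module.End ℝ (Symbols m V₁ V₂) :=
  ∑ i, projAct ρ₁ ρ₂ (b i) * projAct ρ₁ ρ₂
    ((killingForm ℝ (sl (Fin m ⊕ Unit) ℝ)).dualBasis (slKillingForm_nondegenerate ℝ _) b i)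

/-- The space `E = C^∞(ℝ^m, I)` of symbols of degree `k` with values in a subspace
`I ⊆ S^k ℝ^m ⊗ V₁^* ⊗ V₂`, as a subspace of the space of all symbols. -/
def sectionsOf (k : ℕ) (I : Submodule ℝ (SymTensors m V₁ V₂ k)) :
    Submodule ℝ (Symbols m V₁ V₂) :=
  Submodule.map (inclDeg m V₁ V₂ k)
    { carrier := {T | ∀ x, T.1 x ∈ I}
      add_mem' := fun h₁ h₂ x => I.add_mem (h₁ x) (h₂ x)
      zero_mem' := fun _ => I.zero_mem
      smul_mem' := fun c _ h x => I.smul_mem c (h x) }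

end Symbols

/-- The number
`α = 1/(2m) (m δ - k) (m (δ - 1) - k) + m/(m+1) (μ, μ + 2 ρ_S)`. -/
def casimirEigenvalue (m k : ℕ) (δ : ℝ) (μ : Module.Dual ℂ (cartan m)) : ℂ :=
  1 / (2 * (m : ℂ)) * ((m : ℂ) * δ - k) * ((m : ℂ) * (δ - 1) - k)
    + (m : ℂ) / ((m : ℂ) + 1) * weightForm μ (μ + (2 : ℂ) • weylVector m)

end ProjectiveSymbols

end

noncomputable section

namespace ProjectiveSymbols

open LieAlgebra.SpecialLinear
open scoped Matrix ComplexOrder ContDiff DirectSum TensorProduct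

/-! ### Positive definite bilinear forms -/

section Forms

variable {V : Type*} [AddCommGroup V] [Module ℝ V]

/-! The heart of the matter is a cancellation: on symbols of fixed degree the Casimir operator has
order zero. The Killing form of sl(m+1) is 2(m+1) tr(AB), so `C` is 1/(2(m+1)) times the sum of all
products L(E_ac) L(E_ca), each E_ac being made trace-free (`sum_mul_dualBasis`). The corresponding
fields are linear (-x_j e_i), the Euler field, constant (-e_i) and quadratic (x_i x). In the sum
every term containing a derivative of the symbol disappears (`casimir_lieD`), and what remains acts
on values: ∑ E_ij E_ji + Id² + (m+1) Id, taken in the differential of ρ on S^k (`casimirDeg_apply`).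

Thus `C` on C^∞(ℝ^m, I) is governed by the Casimir operator of gl(m) on I. The identity acts on S^k
by the scalar c = k - a₁ + a₂ = k - mδ, so irreducibility under sl(m) and under gl(m) agree, and c
is also the sum of the gl-weights of a highest weight vector. The gl-Casimir commutes with the
action, hence is constant on an irreducible I and may be read off on a highest weight vector
(`IsContravariantRep.glCasimir_apply`). An identity of polynomials in the weights turns the result
into the stated α (`casimirEigenvalue_weightOf`).

The representation theory rests on one device: an inner product for which the adjoint of ρ(a) is
ρ(aᵀ). It exists on tensors, restricts to Young modules and symmetric tensors, and extends to
Hom(V₁, V₂) by the Hilbert-Schmidt form (`youngRep_contravariant`, `symbolRep_contravariant`). With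
it, orthogonal complements of invariant subspaces are invariant, which gives complete reducibility,
and diagonal matrices are symmetric, which gives real weights and highest weight vectors without
leaving ℝ. The highest weight is unique because diagonal matrices act by scalars on all highest
weight vectors of an irreducible module (`IsContravariantRep.exists_weight`).

Finally, projections of S^k onto its summands are constant linear maps and so preserve smoothness;
the decomposition of values becomes one of symbols (`isInternal_sectionsOf`), each piece lying in an
eigenspace. -/

/-- A positive definite symmetric bilinear form. -/
structure IsInnerForm (β : LinearMap.BilinForm ℝ V) : Prop where
  symm : ∀ u v, β u v = β v u
  pos : ∀ v, v ≠ 0 → 0 < β v v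

/-- The inner product space core defined by a positive definite form. -/
@[reducible]
def IsInnerForm.core {β : LinearMap.BilinForm ℝ V} (hβ : IsInnerForm β) :
    InnerProductSpace.Core ℝ V where
  inner u v := β u v
  conj_inner_symm u v := by simpa using hβ.symm v u
  re_inner_nonneg v := by
    by_cases h : v = 0
    · simp [h]
    · simpa using (hβ.pos v h).le
  add_left u v w := by simp
  smul_left u v r := by simp
  definite v h := by
    by_contra h0
    exact (hβ.pos v h0).ne' h

theorem IsInnerForm.eq_zero {β : LinearMap.BilinForm ℝ V} (hβ : IsInnerForm β) {v : V}
    (h : β v v = 0) : v = 0 := by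
  by_contra h0
  exact (hβ.pos v h0).ne' h

/-- A positive definite form on a finite-dimensional space has an orthonormal basis. -/
theorem IsInnerForm.exists_orthonormal [FiniteDimensional ℝ V] {β : LinearMap.BilinForm ℝ V}
    (hβ : IsInnerForm β) : ∃ e : Module.Basis (Fin (Module.finrank ℝ V)) ℝ V,
      ∀ i j, β (e i) (e j) = if i = j then 1 else 0 := by
  let : NormedAddCommGroup V := hβ.core.toNormedAddCommGroup
  let : InnerProductSpace ℝ V := .ofCore hβ.core.toCore
  refine ⟨(stdOrthonormalBasis ℝ V).toBasis, fun i j => ?_⟩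
  have h := orthonormal_iff_ite.1 (stdOrthonormalBasis ℝ V).orthonormal i j
  rw [OrthonormalBasis.coe_toBasis]
  exact h

/-- A symmetric operator has an eigenvector in each nonzero invariant subspace. -/
theorem IsInnerForm.exists_eigenvector [FiniteDimensional ℝ V] {β : LinearMap.BilinForm ℝ V}
    (hβ : IsInnerForm β) (f : Module.End ℝ V) (hf : ∀ u v, β (f u) v = β u (f v))
    (N : Submodule ℝ V) (hN : ∀ v ∈ N, f v ∈ N) (h0 : N ≠ ⊥) :
    ∃ t : ℝ, ∃ v ∈ N, v ≠ 0 ∧ f v = t • v := by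
  let : NormedAddCommGroup V := hβ.core.toNormedAddCommGroup
  let : InnerProductSpace ℝ V := .ofCore hβ.core.toCore
  have hs : (f.restrict hN).IsSymmetric := fun u v => hf u v
  have : Nontrivial N := Submodule.nontrivial_iff_ne_bot.2 h0
  obtain ⟨v, hv⟩ := hs.hasEigenvalue_iSup_of_finiteDimensional.exists_hasEigenvector
  have h1 := congrArg Subtype.val hv.apply_eq_smul
  exact ⟨_, v, v.2, fun h => hv.2 (Subtype.ext h), h1⟩

/-- Positivity passes to every subspace, so the restricted form is nondegenerate. -/
theorem IsInnerForm.isCompl [FiniteDimensional ℝ V] {β : LinearMap.BilinForm ℝ V}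
    (hβ : IsInnerForm β) (N : Submodule ℝ V) : IsCompl N (β.orthogonal N) := by
  have hr : β.IsRefl := fun u v h => by rw [hβ.symm, h]
  refine LinearMap.BilinForm.isCompl_orthogonal_of_restrict_nondegenerate hr ?_
  have hr' : (β.restrict N).IsRefl := fun u v h => hr _ _ h
  refine (hr'.nondegenerate_iff_separatingLeft).2 fun u hu => Subtype.ext ?_
  exact hβ.eq_zero (hu u)

/-- A nonzero finite-dimensional invariant subspace of a symmetric operator `f` contains
an eigenvector for the largest eigenvalue of `f`. -/
theorem IsInnerForm.exists_max_eigenvector [FiniteDimensional ℝ V] {β : LinearMap.BilinForm ℝ V}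
    (hβ : IsInnerForm β) (f : Module.End ℝ V) (hf : ∀ u v, β (f u) v = β u (f v))
    (N : Submodule ℝ V) (hN : ∀ v ∈ N, f v ∈ N) (h0 : N ≠ ⊥) :
    ∃ t : ℝ, ∃ v ∈ N, v ≠ 0 ∧ f v = t • v ∧ ∀ s > t, ∀ w ∈ N, f w = s • w → w = 0 := by
  let S : Set ℝ := {t | ∃ v ∈ N, v ≠ 0 ∧ f v = t • v}
  have hfin : S.Finite := by
    refine (Module.End.finite_hasEigenvalue f).subset ?_
    rintro t ⟨v, -, hv, h⟩
    exact Module.End.hasEigenvalue_of_hasEigenvector (x := v)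
      ⟨Module.End.mem_eigenspace_iff.2 h, hv⟩
  obtain ⟨t, ht⟩ := hβ.exists_eigenvector f hf N hN h0
  obtain ⟨t, ⟨v, hvN, hv0, hv⟩, hmax⟩ := hfin.exists_maximal ⟨t, ht⟩
  refine ⟨t, v, hvN, hv0, hv, fun s hs w hw hfw => ?_⟩
  by_contra hw0
  exact absurd (hmax ⟨w, hw, hw0, hfw⟩ hs.le) (not_le.2 hs)

end Forms

/-! ### Representations of `gl(m, ℝ)` with a contravariant inner product -/

/-- A representation of `gl(m, ℝ)` on which the identity acts by the scalar `c`, with an inner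
product for which the adjoint of the action of `A` is the action of `Aᵀ`. -/
structure IsContravariantRep {m : ℕ} {V : Type*} [AddCommGroup V] [Module ℝ V]
    (R : Matrix (Fin m) (Fin m) ℝ →ₗ[ℝ] Module.End ℝ V) (c : ℝ) (β : LinearMap.BilinForm ℝ V) :
    Prop where
  inner : IsInnerForm β
  bracket : ∀ A B, R (A * B - B * A) = R A * R B - R B * R A
  one : R 1 = c • 1
  adj : ∀ A u v, β (R A u) v = β u (R Aᵀ v)

section Rep

variable {m : ℕ} {V : Type*} [AddCommGroup V] [Module ℝ V]
  {R : Matrix (Fin m) (Fin m) ℝ →ₗ[ℝ] Module.End ℝ V} {c : ℝ} {β : LinearMap.BilinForm ℝ V}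

/-- Invariance of a subspace under `gl(m, ℝ)`. -/
def IsGlInvariant (R : Matrix (Fin m) (Fin m) ℝ →ₗ[ℝ] Module.End ℝ V) (N : Submodule ℝ V) : Prop :=
  ∀ A, ∀ v ∈ N, R A v ∈ N

/-- Irreducibility of a subspace under `gl(m, ℝ)`. -/
def IsGlIrreducible (R : Matrix (Fin m) (Fin m) ℝ →ₗ[ℝ] Module.End ℝ V) (N : Submodule ℝ V) :
    Prop :=
  IsGlInvariant R N ∧ N ≠ ⊥ ∧ ∀ N' : Submodule ℝ V, IsGlInvariant R N' → N' ≤ N → N' = ⊥ ∨ N' = N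

theorem IsContravariantRep.invariant_orthogonal (h : IsContravariantRep R c β)
    {N : Submodule ℝ V} (hN : IsGlInvariant R N) : IsGlInvariant R (β.orthogonal N) := by
  intro A v hv u hu
  change β u (R A v) = 0
  have h1 := h.adj Aᵀ u v
  rw [Matrix.transpose_transpose] at h1
  rw [← h1]
  exact hv _ (hN _ _ hu)

/-- Induction on a bound `d` for the dimension: a reducible `N` splits into a proper invariant
subspace and the orthogonal complement of that subspace inside `N`. Orthogonality of the pieces is
carried along because independence then follows from positivity. -/
theorem IsContravariantRep.exists_orthogonal_irreducible [FiniteDimensional ℝ V]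
    (h : IsContravariantRep R c β) (d : ℕ) : ∀ N : Submodule ℝ V, Module.finrank ℝ N ≤ d →
      IsGlInvariant R N → ∃ (ι : Type) (_ : Fintype ι) (I : ι → Submodule ℝ V),
        (∀ s, IsGlIrreducible R (I s)) ∧ (∀ s t, s ≠ t → I s ≤ β.orthogonal (I t)) ∧
          ⨆ s, I s = N := by
  induction d with
  | zero =>
    intro N hd _
    have h0 : N = ⊥ := Submodule.finrank_eq_zero.1 (Nat.le_zero.1 hd)
    exact ⟨Empty, inferInstance, Empty.elim, fun s => s.elim, fun s => s.elim, by simp [h0]⟩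
  | succ d ih =>
    intro N hd hN
    by_cases h0 : N = ⊥
    · exact ⟨Empty, inferInstance, Empty.elim, fun s => s.elim, fun s => s.elim, by simp [h0]⟩
    by_cases hirr : IsGlIrreducible R N
    · exact ⟨Unit, inferInstance, fun _ => N, fun _ => hirr, fun s t hst => (hst rfl).elim,
        by simp⟩
    obtain ⟨N', hN', hle, hbot, hne⟩ : ∃ N', IsGlInvariant R N' ∧ N' ≤ N ∧ N' ≠ ⊥ ∧ N' ≠ N := by
      by_contra! hcon
      refine hirr ⟨hN, h0, fun N' h1 h2 => ?_⟩
      by_contra! h3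
      exact h3.2 (hcon N' h1 h2 h3.1)
    have hc := h.inner.isCompl N'
    have hsup : N' ⊔ N ⊓ β.orthogonal N' = N := by
      -- This is the modular law, available because `N' ≤ N`.
      rw [inf_comm, ← sup_inf_assoc_of_le _ hle, hc.sup_eq_top, top_inf_eq]
    have hlt1 : N' < N := lt_of_le_of_ne hle hne
    have hlt2 : N ⊓ β.orthogonal N' < N := by
      refine lt_of_le_of_ne inf_le_left fun heq => hbot ?_
      have h1 : N' ≤ β.orthogonal N' := hle.trans (heq ▸ inf_le_right)
      exact le_bot_iff.1 (hc.disjoint le_rfl h1)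
    have hinv2 : IsGlInvariant R (N ⊓ β.orthogonal N') := fun A v hv =>
      ⟨hN A v hv.1, h.invariant_orthogonal hN' A v hv.2⟩
    obtain ⟨ι₁, _, I₁, hI₁, ho₁, hs₁⟩ := ih N'
      (by have := Submodule.finrank_lt_finrank_of_lt hlt1; omega) hN'
    obtain ⟨ι₂, _, I₂, hI₂, ho₂, hs₂⟩ := ih (N ⊓ β.orthogonal N')
      (by have := Submodule.finrank_lt_finrank_of_lt hlt2; omega) hinv2
    have hle₁ : ∀ s, I₁ s ≤ N' := fun s => hs₁ ▸ le_iSup I₁ s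
    have hle₂ : ∀ s, I₂ s ≤ β.orthogonal N' := fun s =>
      (le_iSup I₂ s).trans (hs₂.le.trans inf_le_right)
    refine ⟨ι₁ ⊕ ι₂, inferInstance, Sum.elim I₁ I₂, ?_, ?_, ?_⟩
    · rintro (s | s)
      exacts [hI₁ s, hI₂ s]
    · rintro (s | s) (t | t) hst
      · exact ho₁ s t fun h => hst (by rw [h])
      · intro v hv u hu
        exact (h.inner.symm u v).trans (hle₂ t hu v (hle₁ s hv))
      · intro v hv u hu
        exact hle₂ s hv u (hle₁ t hu)
      · exact ho₂ s t fun h => hst (by rw [h])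
    · rw [iSup_sum]
      simp only [Sum.elim_inl, Sum.elim_inr]
      rw [hs₁, hs₂, hsup]

/-- Complete reducibility. -/
theorem IsContravariantRep.exists_isInternal_irreducible [FiniteDimensional ℝ V]
    (h : IsContravariantRep R c β) : ∃ (n : ℕ) (I : Fin n → Submodule ℝ V),
      DirectSum.IsInternal I ∧ ∀ s, IsGlIrreducible R (I s) := by
  obtain ⟨ι, _, I, hI, ho, hs⟩ := h.exists_orthogonal_irreducible _ ⊤ le_rfl
    fun _ _ _ => Submodule.mem_top
  let e := Fintype.equivFin ι
  refine ⟨Fintype.card ι, I ∘ e.symm, ?_, fun s => hI _⟩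
  rw [DirectSum.isInternal_submodule_iff_iSupIndep_and_iSup_eq_top]
  refine ⟨fun s => ?_, ?_⟩
  · rw [disjoint_iff_inf_le]
    rintro v ⟨hv, hv'⟩
    refine h.inner.eq_zero ?_
    have hle : ⨆ t, ⨆ (_ : t ≠ s), (I ∘ e.symm) t ≤ LinearMap.ker (β v) := by
      refine iSup₂_le fun t ht u hu => ?_
      exact ho _ (e.symm s) (fun h => ht (e.symm.injective h)) hu v hv
    exact hle hv'
  · rw [← hs]
    exact e.symm.iSup_comp (g := I)

/-! ### Highest weight vectors -/

/-- The vectors of `N` that are annihilated by the root vectors `E_{ij}`, `i < j`. -/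
def highestSpace (R : Matrix (Fin m) (Fin m) ℝ →ₗ[ℝ] Module.End ℝ V) (N : Submodule ℝ V) :
    Submodule ℝ V where
  carrier := {v | v ∈ N ∧ ∀ i j : Fin m, i < j → R (Matrix.single i j 1) v = 0}
  add_mem' hu hv := ⟨N.add_mem hu.1 hv.1, fun i j hij => by
    rw [map_add, hu.2 i j hij, hv.2 i j hij, add_zero]⟩
  zero_mem' := ⟨N.zero_mem, fun _ _ _ => map_zero _⟩
  smul_mem' t v hv := ⟨N.smul_mem t hv.1, fun i j hij => by
    rw [map_smul, hv.2 i j hij, smul_zero]⟩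

theorem IsContravariantRep.bracket_apply (h : IsContravariantRep R c β)
    (A B : Matrix (Fin m) (Fin m) ℝ) (v : V) :
    R A (R B v) = R B (R A v) + R (A * B - B * A) v := by
  rw [h.bracket]
  simp

theorem diagonal_commutator_single (d : Fin m → ℝ) (i j : Fin m) :
    Matrix.diagonal d * Matrix.single i j 1 - Matrix.single i j 1 * Matrix.diagonal d
      = (d i - d j) • Matrix.single i j (1 : ℝ) := by
  ext a b
  simp only [Matrix.sub_apply, Matrix.diagonal_mul, Matrix.mul_diagonal, Matrix.smul_apply,
    Matrix.single_apply, smul_eq_mul]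
  split_ifs with hab
  · rw [hab.1, hab.2]; ring
  · ring

/-- A root vector shifts the eigenvalues of a diagonal matrix by the value of its root. -/
theorem IsContravariantRep.diagonal_single (h : IsContravariantRep R c β) (d : Fin m → ℝ)
    (i j : Fin m) (v : V) :
    R (Matrix.diagonal d) (R (Matrix.single i j 1) v)
      = R (Matrix.single i j 1) (R (Matrix.diagonal d) v)
        + (d i - d j) • R (Matrix.single i j 1) v := by
  rw [h.bracket_apply, diagonal_commutator_single, map_smul, LinearMap.smul_apply]

theorem IsContravariantRep.adj_diagonal (h : IsContravariantRep R c β) (d : Fin m → ℝ) (u v : V) :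
    β (R (Matrix.diagonal d) u) v = β u (R (Matrix.diagonal d) v) := by
  rw [h.adj, Matrix.diagonal_transpose]

/-- Take an eigenvector for the largest eigenvalue of a diagonal matrix on which all positive roots
are positive: each `E_ij` with `i < j` would raise the eigenvalue, so it kills the vector. -/
theorem IsContravariantRep.highestSpace_ne_bot [FiniteDimensional ℝ V]
    (h : IsContravariantRep R c β) {N : Submodule ℝ V} (hN : IsGlInvariant R N) (h0 : N ≠ ⊥) :
    highestSpace R N ≠ ⊥ := by
  -- Only strict decrease of the entries matters; the trace need not vanish since the action is one
  -- of gl(m).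
  let d : Fin m → ℝ := fun i => -(i : ℕ)
  obtain ⟨t, v, hvN, hv0, hv, hmax⟩ := h.inner.exists_max_eigenvector (R (Matrix.diagonal d))
    (h.adj_diagonal d) N (hN _) h0
  intro hbot
  refine hv0 ((Submodule.eq_bot_iff _).1 hbot v ⟨hvN, fun i j hij => ?_⟩)
  have hd : 0 < d i - d j := by
    have : ((i : ℕ) : ℝ) < (j : ℕ) := by exact_mod_cast hij
    simp only [d]; linarith
  refine hmax (t + (d i - d j)) (by linarith) _ (hN _ _ hvN) ?_
  rw [h.diagonal_single, hv, map_smul, add_smul]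

theorem IsContravariantRep.diagonal_mem_highestSpace (h : IsContravariantRep R c β)
    {N : Submodule ℝ V} (hN : IsGlInvariant R N) (d : Fin m → ℝ) {v : V}
    (hv : v ∈ highestSpace R N) : R (Matrix.diagonal d) v ∈ highestSpace R N := by
  refine ⟨hN _ _ hv.1, fun i j hij => ?_⟩
  have h1 := h.diagonal_single d i j v
  rw [hv.2 i j hij] at h1
  simpa using h1.symm

theorem matrix_eq_sum_single (A : Matrix (Fin m) (Fin m) ℝ) :
    A = ∑ i, ∑ j, A i j • Matrix.single i j (1 : ℝ) := by
  conv_lhs => rw [Matrix.matrix_eq_sum_single A]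
  simp [Matrix.smul_single]

/-- A subspace of highest weight vectors which is stable under the diagonal matrices generates
an irreducible representation under the lower triangular matrices. -/
theorem IsContravariantRep.lower_induction (h : IsContravariantRep R c β) {N : Submodule ℝ V}
    (hN : IsGlIrreducible R N) {K : Submodule ℝ V} (hK : K ≤ highestSpace R N) (hK0 : K ≠ ⊥)
    (hd : ∀ i, ∀ v ∈ K, R (Matrix.single i i 1) v ∈ K) {P : Submodule ℝ V} (hKP : K ≤ P)
    (hP : ∀ i j : Fin m, j < i → ∀ v ∈ P, R (Matrix.single i j 1) v ∈ P) : N ≤ P := by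
  let W : Submodule ℝ V := sInf {Q | K ≤ Q ∧ ∀ i j : Fin m, j < i → ∀ v ∈ Q,
    R (Matrix.single i j 1) v ∈ Q}
  have hKW : K ≤ W := le_sInf fun Q hQ => hQ.1
  have hWst : ∀ i j : Fin m, j < i → ∀ v ∈ W, R (Matrix.single i j 1) v ∈ W := by
    intro i j hij v hv
    rw [Submodule.mem_sInf] at hv ⊢
    exact fun Q hQ => hQ.2 i j hij v (hv Q hQ)
  have hWle : ∀ Q : Submodule ℝ V, K ≤ Q → (∀ i j : Fin m, j < i → ∀ v ∈ Q,
      R (Matrix.single i j 1) v ∈ Q) → W ≤ Q := fun Q h1 h2 => sInf_le ⟨h1, h2⟩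
  -- `W` is the smallest candidate for `P`; `W'` consists of the vectors of `W` that every matrix
  -- sends into `W`. Minimality of `W` will give `W ≤ W'`, hence invariance under all of gl(m).
  let W' : Submodule ℝ V :=
    { carrier := {v | v ∈ W ∧ ∀ A, R A v ∈ W}
      add_mem' := fun hu hv => ⟨W.add_mem hu.1 hv.1, fun A => by
        rw [map_add]; exact W.add_mem (hu.2 A) (hv.2 A)⟩
      zero_mem' := ⟨W.zero_mem, fun A => by rw [map_zero]; exact W.zero_mem⟩
      smul_mem' := fun t v hv => ⟨W.smul_mem t hv.1, fun A => by
        rw [map_smul]; exact W.smul_mem t (hv.2 A)⟩ }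
  have hWW' : W ≤ W' := by
    refine hWle W' (fun v hv => ⟨hKW hv, fun A => ?_⟩) fun i j hij v hv =>
      ⟨hWst i j hij v hv.1, fun A => ?_⟩
    · rw [matrix_eq_sum_single A]
      simp only [map_sum, map_smul, LinearMap.sum_apply, LinearMap.smul_apply]
      refine W.sum_mem fun i _ => W.sum_mem fun j _ => W.smul_mem _ ?_
      rcases lt_trichotomy i j with hij | rfl | hij
      · rw [(hK hv).2 i j hij]; exact W.zero_mem
      · exact hKW (hd i v hv)
      · exact hWst i j hij v (hKW hv)
    -- For lowering E: A E v = E A v + [A, E] v, and both terms lie in `W` because `v` is in `W'`.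
    · rw [h.bracket_apply]
      exact W.add_mem (hWst i j hij _ (hv.2 A)) (hv.2 _)
  have hWN : W = N := by
    refine (hN.2.2 W (fun A v hv => (hWW' hv).2 A) ?_).resolve_left fun h0 =>
      hK0 (le_bot_iff.1 (h0 ▸ hKW))
    exact hWle N (fun v hv => (hK hv).1) fun i j _ v hv => hN.1 _ v hv
  exact hWN ▸ hWle P hKP hP

/-- A diagonal matrix acts by a scalar on the highest weight vectors of an irreducible
representation. -/
theorem IsContravariantRep.exists_weight [FiniteDimensional ℝ V]
    (h : IsContravariantRep R c β) {N : Submodule ℝ V} (hN : IsGlIrreducible R N)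
    (d : Fin m → ℝ) : ∃ t : ℝ, ∀ v ∈ highestSpace R N, R (Matrix.diagonal d) v = t • v := by
  obtain ⟨t, v, hv, hv0, hvt⟩ := h.inner.exists_eigenvector (R (Matrix.diagonal d))
    (h.adj_diagonal d) (highestSpace R N) (fun v hv => h.diagonal_mem_highestSpace hN.1 d hv)
    (h.highestSpace_ne_bot hN.1 hN.2.1)
  refine ⟨t, fun u hu => ?_⟩
  -- One eigenvalue `t` is at hand. The module is generated from its eigenspace `K` by lowering, and
  -- the defect `u'` of any other highest weight vector is shown to be orthogonal to everything
  -- generated, including itself.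
  let K : Submodule ℝ V := highestSpace R N ⊓ Module.End.eigenspace (R (Matrix.diagonal d)) t
  have hmem : ∀ w ∈ K, R (Matrix.diagonal d) w = t • w := fun w hw =>
    Module.End.mem_eigenspace_iff.1 hw.2
  let u' : V := R (Matrix.diagonal d) u - t • u
  have hu' : u' ∈ highestSpace R N :=
    sub_mem (h.diagonal_mem_highestSpace hN.1 d hu) (Submodule.smul_mem _ t hu)
  have hle : N ≤ LinearMap.ker (β u') := by
    refine h.lower_induction hN (K := K) inf_le_left ?_ ?_ ?_ ?_
    · intro hbot
      exact hv0 ((Submodule.eq_bot_iff _).1 hbot v ⟨hv, Module.End.mem_eigenspace_iff.2 hvt⟩)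
    · intro i w hw
      have hsi : Matrix.single i i (1 : ℝ) = Matrix.diagonal (Pi.single i 1) :=
        (Matrix.diagonal_single i 1).symm
      refine ⟨hsi ▸ h.diagonal_mem_highestSpace hN.1 _ hw.1, Module.End.mem_eigenspace_iff.2 ?_⟩
      rw [h.diagonal_single, hmem w hw, map_smul, sub_self, zero_smul, add_zero]
    · intro w hw
      change β u' w = 0
      simp only [u', map_sub, map_smul, LinearMap.sub_apply, LinearMap.smul_apply]
      rw [h.adj_diagonal, hmem w hw, map_smul, sub_self]
    -- The adjoint of a lowering operator is a raising operator, which kills `u'`; hence all lowered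
    -- vectors are orthogonal to `u'`.
    · intro i j hij w _
      change β u' _ = 0
      rw [h.inner.symm, h.adj, Matrix.transpose_single, hu'.2 j i hij, map_zero]
  exact sub_eq_zero.1 (h.inner.eq_zero (hle hu'.1))

/-! ### The Casimir operator of `gl(m, ℝ)` -/

/-- The operator `∑ i j, E_{ij} E_{ji}`. -/
def glCasimir (R : Matrix (Fin m) (Fin m) ℝ →ₗ[ℝ] Module.End ℝ V) : Module.End ℝ V :=
  ∑ i, ∑ j, R (Matrix.single i j 1) * R (Matrix.single j i 1)

theorem mul_single_eq_sum (A : Matrix (Fin m) (Fin m) ℝ) (i j : Fin m) :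
    A * Matrix.single i j 1 = ∑ k, A k i • Matrix.single k j (1 : ℝ) := by
  ext a b
  simp only [Matrix.sum_apply, Matrix.smul_apply, Matrix.single_apply, smul_eq_mul]
  by_cases hb : j = b
  · subst hb
    simp
  · rw [Matrix.mul_single_apply_of_ne _ _ _ _ _ (Ne.symm hb)]
    simp [hb]

theorem single_mul_eq_sum (A : Matrix (Fin m) (Fin m) ℝ) (i j : Fin m) :
    Matrix.single i j 1 * A = ∑ k, A j k • Matrix.single i k (1 : ℝ) := by
  ext a b
  simp only [Matrix.sum_apply, Matrix.smul_apply, Matrix.single_apply, smul_eq_mul]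
  by_cases ha : i = a
  · subst ha
    simp
  · rw [Matrix.single_mul_apply_of_ne _ _ _ _ _ (Ne.symm ha)]
    simp [ha]

/-- The tensor ∑ E_ij ⊗ E_ji is invariant: expanding the brackets with `A` gives four triple sums
that cancel in pairs after renaming indices. -/
theorem IsContravariantRep.glCasimir_comm (h : IsContravariantRep R c β)
    (A : Matrix (Fin m) (Fin m) ℝ) : R A * glCasimir R = glCasimir R * R A := by
  have key : ∀ i j, R A * (R (Matrix.single i j 1) * R (Matrix.single j i 1))
      - R (Matrix.single i j 1) * R (Matrix.single j i 1) * R A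
      = R (A * Matrix.single i j 1 - Matrix.single i j 1 * A) * R (Matrix.single j i 1)
        + R (Matrix.single i j 1) * R (A * Matrix.single j i 1 - Matrix.single j i 1 * A) := by
    intro i j
    rw [h.bracket, h.bracket]
    noncomm_ring
  rw [← sub_eq_zero, glCasimir]
  simp only [Finset.mul_sum, Finset.sum_mul, ← Finset.sum_sub_distrib, key]
  simp only [mul_single_eq_sum, single_mul_eq_sum, map_sub, map_sum, map_smul, sub_mul, mul_sub,
    Finset.sum_mul, Finset.mul_sum, smul_mul_assoc, mul_smul_comm, Finset.sum_add_distrib,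
    Finset.sum_sub_distrib]
  have e1 : ∑ i, ∑ j, ∑ k, A k i • (R (Matrix.single k j 1) * R (Matrix.single j i 1))
      = ∑ i, ∑ j, ∑ k, A i k • (R (Matrix.single i j 1) * R (Matrix.single j k 1)) := by
    rw [Finset.sum_comm]
    conv_rhs => rw [Finset.sum_comm]
    exact Finset.sum_congr rfl fun j _ => Finset.sum_comm
  have e2 : ∑ i, ∑ j, ∑ k, A j k • (R (Matrix.single i k 1) * R (Matrix.single j i 1))
      = ∑ i, ∑ j, ∑ k, A k j • (R (Matrix.single i j 1) * R (Matrix.single k i 1)) :=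
    Finset.sum_congr rfl fun j _ => Finset.sum_comm
  rw [e1, e2]
  abel

/-- The action of the Casimir operator of `gl(m, ℝ)` on an irreducible representation. -/
theorem IsContravariantRep.glCasimir_apply [FiniteDimensional ℝ V] (h : IsContravariantRep R c β)
    {N : Submodule ℝ V} (hN : IsGlIrreducible R N) {w : Fin m → ℝ}
    (hw : ∀ i, ∀ v ∈ highestSpace R N, R (Matrix.single i i 1) v = w i • v) {v : V} (hv : v ∈ N) :
    glCasimir R v
      = (∑ i, ∑ j, if i = j then w i ^ 2 else if i < j then w i - w j else 0) • v := by
  set α : ℝ := ∑ i, ∑ j, if i = j then w i ^ 2 else if i < j then w i - w j else 0 with hα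
  let P : Submodule ℝ V := N ⊓ Module.End.eigenspace (glCasimir R) α
  have hK : highestSpace R N ≤ P := by
    intro u hu
    refine ⟨hu.1, Module.End.mem_eigenspace_iff.2 ?_⟩
    rw [glCasimir, hα]
    simp only [LinearMap.sum_apply, Finset.sum_smul, Module.End.mul_apply]
    refine Finset.sum_congr rfl fun i _ => Finset.sum_congr rfl fun j _ => ?_
    rcases lt_trichotomy i j with hij | rfl | hij
    -- Move the raising operator to the right, where it vanishes; the bracket left over is E_ii -
    -- E_jj.
    · rw [h.bracket_apply, hu.2 i j hij, map_zero, zero_add, map_sub, LinearMap.sub_apply,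
        Matrix.single_mul_single_same, Matrix.single_mul_single_same, mul_one, hw i u hu,
        hw j u hu, if_neg hij.ne, if_pos hij, sub_smul]
    · rw [hw i u hu, map_smul, hw i u hu, if_pos rfl, smul_smul, sq]
    · rw [hu.2 j i hij, map_zero, if_neg hij.ne', if_neg hij.not_gt, zero_smul]
  have hPinv : IsGlInvariant R P := by
    intro A u hu
    refine ⟨hN.1 A u hu.1, Module.End.mem_eigenspace_iff.2 ?_⟩
    have h1 := LinearMap.congr_fun (h.glCasimir_comm A) u
    rw [Module.End.mul_apply, Module.End.mul_apply, Module.End.mem_eigenspace_iff.1 hu.2,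
      map_smul] at h1
    exact h1.symm
  -- The eigenspace is invariant and contains the nonzero space of highest weight vectors, so
  -- irreducibility makes it all of `N`.
  have hPN : P = N := (hN.2.2 P hPinv inf_le_left).resolve_left fun h0 =>
    h.highestSpace_ne_bot hN.1 hN.2.1 (le_bot_iff.1 (h0 ▸ hK))
  exact Module.End.mem_eigenspace_iff.1 (hPN ▸ hv : v ∈ P).2

end Rep

/-! ### Weights -/

/-- With indices from 0, `w i` occurs m - 1 - i times with a plus sign and i times with a minus
sign. -/
theorem sum_lt_sub_eq {m : ℕ} (w : Fin m → ℝ) :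
    (∑ i, ∑ j, if i < j then w i - w j else 0) = ∑ i, w i * ((m : ℝ) - 1 - 2 * (i : ℕ)) := by
  have h1 : ∀ i : Fin m, (∑ j, if i < j then w i else 0) = w i * ((m : ℝ) - 1 - (i : ℕ)) := by
    intro i
    rw [← Finset.sum_filter, Finset.sum_const, nsmul_eq_mul, mul_comm]
    congr 1
    have h2 : (Finset.univ.filter fun j => i < j) = Finset.Ioi i := by ext; simp
    have hi := i.2
    rw [h2, Fin.card_Ioi, Nat.cast_sub (by omega), Nat.cast_sub (by omega)]
    simp
  have h3 : ∀ i : Fin m, (∑ j, if j < i then w i else 0) = w i * (i : ℕ) := by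
    intro i
    rw [← Finset.sum_filter, Finset.sum_const, nsmul_eq_mul, mul_comm]
    congr 1
    have h2 : (Finset.univ.filter fun j => j < i) = Finset.Iio i := by ext; simp
    rw [h2, Fin.card_Iio]
  have h4 : ∀ i j : Fin m, (if i < j then w i - w j else 0)
      = (if i < j then w i else 0) - if i < j then w j else 0 := by
    intro i j; split_ifs <;> simp
  simp only [h4, Finset.sum_sub_distrib, h1]
  rw [Finset.sum_comm (f := fun i j => if i < j then w j else 0)]
  simp only [h3, ← Finset.sum_sub_distrib]
  exact Finset.sum_congr rfl fun i _ => by ring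

theorem sum_weights_eq {m : ℕ} (w : Fin m → ℝ) :
    (∑ i, ∑ j, if i = j then w i ^ 2 else if i < j then w i - w j else 0)
      = ∑ i, w i ^ 2 + ∑ i, w i * ((m : ℝ) - 1 - 2 * (i : ℕ)) := by
  rw [← sum_lt_sub_eq, ← Finset.sum_add_distrib]
  refine Finset.sum_congr rfl fun i _ => ?_
  have h : ∀ j, (if i = j then w i ^ 2 else if i < j then w i - w j else 0)
      = (if i = j then w i ^ 2 else 0) + if i < j then w i - w j else 0 := by
    intro j
    by_cases hij : i = j
    · subst hij; simp
    · simp [hij]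
  simp only [h, Finset.sum_add_distrib, Finset.sum_ite_eq, Finset.mem_univ, if_true]

/-- The linear combination `∑ i, a i δ_i` of the coordinate weights. -/
def weightOf {m : ℕ} (a : Fin m → ℂ) : Module.Dual ℂ (cartan m) := ∑ i, a i • coordWeight i

theorem weightOf_apply {m : ℕ} (a : Fin m → ℂ) (H : cartan m) :
    weightOf a H = ∑ i, a i * H.1.1 i i := by
  rw [weightOf, LinearMap.sum_apply]
  rfl

/-- The element of the Cartan subalgebra dual to a weight for the Killing form. -/
def coweight {m : ℕ} (hm : m ≠ 0) (a : Fin m → ℂ) : cartan m :=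
  ⟨⟨Matrix.diagonal fun i : Fin m => (2 * (m : ℂ))⁻¹ * (a i - (∑ j, a j) / m), by
    have h : (m : ℂ) ≠ 0 := Nat.cast_ne_zero.2 hm
    change Matrix.trace (Matrix.diagonal fun i : Fin m => _) = 0
    rw [Matrix.trace_diagonal, ← Finset.mul_sum, Finset.sum_sub_distrib, Finset.sum_const,
      Finset.card_univ, Fintype.card_fin, nsmul_eq_mul, mul_div_cancel₀ _ h, sub_self, mul_zero]⟩,
    Matrix.isDiag_diagonal _⟩

theorem cartanKilling_apply {m : ℕ} (H H' : cartan m) :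
    cartanKilling m H H' = 2 * (m : ℂ) * ∑ i, H.1.1 i i * H'.1.1 i i := by
  change killingForm ℂ (sl (Fin m) ℂ) H.1 H'.1 = _
  rw [slKillingForm_apply, Fintype.card_fin, Matrix.trace]
  congr 1
  refine Finset.sum_congr rfl fun i _ => ?_
  rw [Matrix.diag_apply, Matrix.mul_apply, Finset.sum_eq_single i]
  · intro j _ hj
    rw [H.2 (Ne.symm hj), zero_mul]
  · simp

/-- On diagonal matrices the Killing form is 2m times the dot product. The mean is subtracted to
land in trace-free matrices; it is invisible to the pairing since ∑ δ_i = 0 on the Cartan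
subalgebra. -/
theorem toDual_symm_weightOf {m : ℕ} (hm : m ≠ 0) (a : Fin m → ℂ) :
    ((cartanKilling m).toDual (cartanKilling_nondegenerate m)).symm (weightOf a)
      = coweight hm a := by
  rw [LinearEquiv.symm_apply_eq]
  ext H
  have h : (m : ℂ) ≠ 0 := Nat.cast_ne_zero.2 hm
  have hH : ∑ i, H.1.1 i i = 0 := H.1.2
  rw [LinearMap.BilinForm.toDual_def, cartanKilling_apply, weightOf_apply]
  simp only [coweight, Matrix.diagonal_apply_eq]
  simp only [mul_assoc, ← Finset.mul_sum, sub_mul, Finset.sum_sub_distrib, hH]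
  field_simp
  simp

theorem weightForm_weightOf {m : ℕ} (hm : m ≠ 0) (a b : Fin m → ℂ) :
    weightForm (weightOf a) (weightOf b)
      = (2 * (m : ℂ))⁻¹ * (∑ i, a i * b i - (∑ i, a i) * (∑ i, b i) / m) := by
  have h : (m : ℂ) ≠ 0 := Nat.cast_ne_zero.2 hm
  have h1 : ∀ H, cartanKilling m (((cartanKilling m).toDual
      (cartanKilling_nondegenerate m)).symm (weightOf a)) H = weightOf a H :=
    fun H => LinearMap.BilinForm.apply_toDual_symm_apply (weightOf a) H
  rw [weightForm, h1, toDual_symm_weightOf hm, weightOf_apply]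
  simp only [coweight, Matrix.diagonal_apply_eq]
  have h2 : ∀ i, a i * ((2 * (m : ℂ))⁻¹ * (b i - (∑ j, b j) / m))
      = (2 * (m : ℂ))⁻¹ * (a i * b i - a i * ((∑ j, b j) / m)) := fun i => by ring
  simp only [h2, ← Finset.mul_sum, Finset.sum_sub_distrib, ← Finset.sum_mul, mul_div_assoc]

/-- Put c = ∑ w_i = k - mδ and let Q be the gl-Casimir value. The weight term equals (Q -
c²/m)/(2(m+1)), and the δ-term equals c(c+m)/(2m). Their sum is (Q + c² + (m+1)c)/(2(m+1)), the form
produced by the computation on symbols. -/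
theorem casimirEigenvalue_weightOf {m : ℕ} (hm : m ≠ 0) (k : ℕ) (δ : ℝ) (w : Fin m → ℝ)
    (hw : ∑ i, w i = k - m * δ) :
    casimirEigenvalue m k δ (weightOf fun i => (w i : ℂ))
      = (((2 * ((m : ℝ) + 1))⁻¹ * ((∑ i, w i ^ 2 + ∑ i, w i * ((m : ℝ) - 1 - 2 * (i : ℕ)))
          + (∑ i, w i) ^ 2 + (m + 1) * ∑ i, w i) : ℝ) : ℂ) := by
  have h : (m : ℝ) ≠ 0 := Nat.cast_ne_zero.2 hm
  have h' : (m : ℝ) + 1 ≠ 0 := by positivity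
  have e1 : weightOf (fun i => (w i : ℂ)) + (2 : ℂ) • weylVector m
      = weightOf fun i => ((w i + 2 * ((m : ℝ) - ((i : ℕ) + 1)) : ℝ) : ℂ) := by
    simp only [weightOf, weylVector, Finset.smul_sum, ← Finset.sum_add_distrib, smul_smul,
      ← add_smul]
    refine Finset.sum_congr rfl fun i _ => ?_
    push_cast
    rfl
  have e2 : ∑ i : Fin m, ((m : ℝ) - ((i : ℕ) + 1)) = m * (m - 1) / 2 := by
    rw [Fin.sum_univ_eq_sum_range (fun i => (m : ℝ) - ((i : ℝ) + 1)) m]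
    clear hw e1 h h' hm w
    have : ∀ n : ℕ, ∑ i ∈ Finset.range n, ((m : ℝ) - ((i : ℝ) + 1)) = n * m - n * (n + 1) / 2 := by
      intro n
      induction n with
      | zero => simp
      | succ n ih => rw [Finset.sum_range_succ, ih]; push_cast; ring
    rw [this]; ring
  -- Here 2(m - 1 - i) is split as (m - 1 - 2i) + (m - 1); the second part cancels later against the
  -- sum of the coefficients of 2ρ_S.
  have e3 : ∑ i, w i * (w i + 2 * ((m : ℝ) - ((i : ℕ) + 1)))
      = (∑ i, w i ^ 2 + ∑ i, w i * ((m : ℝ) - 1 - 2 * (i : ℕ))) + (m - 1) * ∑ i, w i := by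
    rw [Finset.mul_sum, ← Finset.sum_add_distrib, ← Finset.sum_add_distrib]
    exact Finset.sum_congr rfl fun i _ => by ring
  have e4 : ∑ i, (w i + 2 * ((m : ℝ) - ((i : ℕ) + 1))) = ∑ i, w i + m * (m - 1) := by
    rw [Finset.sum_add_distrib, ← Finset.mul_sum, e2]; ring
  rw [casimirEigenvalue, e1, weightForm_weightOf hm]
  simp only [← Complex.ofReal_mul, ← Complex.ofReal_sum]
  rw [e3, e4]
  generalize (∑ i, w i ^ 2 + ∑ i, w i * ((m : ℝ) - 1 - 2 * (i : ℕ))) = q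
  rw [hw]
  norm_cast
  push_cast
  field_simp
  ring

/-! ### Complexification -/

section Complexification

variable {m : ℕ} {V : Type*} [NormedAddCommGroup V] [NormedSpace ℝ V]

/-- The real part of an element of `ℂ ⊗ V`. -/
def rePart (V : Type*) [AddCommGroup V] [Module ℝ V] : ℂ ⊗[ℝ] V →ₗ[ℝ] V :=
  (TensorProduct.lid ℝ V).toLinearMap ∘ₗ LinearMap.rTensor V Complex.reLm

/-- The imaginary part of an element of `ℂ ⊗ V`. -/
def imPart (V : Type*) [AddCommGroup V] [Module ℝ V] : ℂ ⊗[ℝ] V →ₗ[ℝ] V :=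
  (TensorProduct.lid ℝ V).toLinearMap ∘ₗ LinearMap.rTensor V Complex.imLm

theorem rePart_tmul (z : ℂ) (v : V) : rePart V (z ⊗ₜ v) = z.re • v := rfl

theorem imPart_tmul (z : ℂ) (v : V) : imPart V (z ⊗ₜ v) = z.im • v := rfl

theorem rePart_add_imPart (x : ℂ ⊗[ℝ] V) :
    (1 : ℂ) ⊗ₜ[ℝ] rePart V x + Complex.I ⊗ₜ[ℝ] imPart V x = x := by
  induction x with
  | zero => simp
  | add x y hx hy =>
    rw [map_add, map_add, TensorProduct.tmul_add, TensorProduct.tmul_add]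
    nth_rewrite 3 [← hx]
    nth_rewrite 3 [← hy]
    abel
  | tmul z v =>
    rw [rePart_tmul, imPart_tmul, ← TensorProduct.smul_tmul, ← TensorProduct.smul_tmul,
      ← TensorProduct.add_tmul]
    congr 1
    simp

/-- Real operators respect real and imaginary parts, so the conditions on a complex highest weight
vector concerning root vectors hold for each part separately. -/
theorem rePart_baseChange (f : Module.End ℝ V) (x : ℂ ⊗[ℝ] V) :
    rePart V (f.baseChange ℂ x) = f (rePart V x) := by
  induction x with
  | zero => simp
  | add x y hx hy => simp only [map_add, hx, hy]
  | tmul z v => rw [LinearMap.baseChange_tmul, rePart_tmul, rePart_tmul, map_smul]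

theorem imPart_baseChange (f : Module.End ℝ V) (x : ℂ ⊗[ℝ] V) :
    imPart V (f.baseChange ℂ x) = f (imPart V x) := by
  induction x with
  | zero => simp
  | add x y hx hy => simp only [map_add, hx, hy]
  | tmul z v => rw [LinearMap.baseChange_tmul, imPart_tmul, imPart_tmul, map_smul]

theorem parts_mem {N : Submodule ℝ V} {x : ℂ ⊗[ℝ] V} (hx : x ∈ N.baseChange ℂ) :
    rePart V x ∈ N ∧ imPart V x ∈ N := by
  obtain ⟨y, rfl⟩ := hx
  induction y with
  | zero => simp
  | add y z hy hz =>
    simp only [map_add]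
    exact ⟨N.add_mem hy.1 hz.1, N.add_mem hy.2 hz.2⟩
  | tmul z v => exact ⟨N.smul_mem z.re v.2, N.smul_mem z.im v.2⟩

/-- The action of `gl(m, ℝ)` given by the differential of a representation of `GL(m, ℝ)`. -/
def glAction (ρ : GLin m →* (V →L[ℝ] V)) : Matrix (Fin m) (Fin m) ℝ →ₗ[ℝ] Module.End ℝ V where
  toFun A := (diffRep ρ (ofMatrix A) : V →ₗ[ℝ] V)
  map_add' A B := by
    have h : ofMatrix (A + B) = ofMatrix A + ofMatrix B := by simp [ofMatrix]
    rw [h, map_add]; rfl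
  map_smul' t A := by
    have h : ofMatrix (t • A) = t • ofMatrix A := by simp [ofMatrix]
    rw [h, map_smul]; rfl

theorem glAction_apply (ρ : GLin m →* (V →L[ℝ] V)) (A : Matrix (Fin m) (Fin m) ℝ) (v : V) :
    glAction ρ A v = diffRep ρ (ofMatrix A) v := rfl

theorem complexAct_single (ρ : GLin m →* (V →L[ℝ] V)) (i j : Fin m) :
    complexAct ρ (Matrix.single i j 1) = (glAction ρ (Matrix.single i j 1)).baseChange ℂ := by
  have h1 : (Matrix.single i j (1 : ℂ)).map Complex.re = Matrix.single i j 1 := by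
    ext a b; simp only [Matrix.map_apply, Matrix.single_apply]; split_ifs <;> simp
  have h2 : (Matrix.single i j (1 : ℂ)).map Complex.im = 0 := by
    ext a b; simp only [Matrix.map_apply, Matrix.single_apply]; split_ifs <;> simp
  have h3 : complexAct ρ (Matrix.single i j 1)
      = (glAction ρ ((Matrix.single i j (1 : ℂ)).map Complex.re)).baseChange ℂ
        + Complex.I • (glAction ρ ((Matrix.single i j (1 : ℂ)).map Complex.im)).baseChange ℂ := rfl
  rw [h3, h1, h2, map_zero, LinearMap.baseChange_zero, smul_zero, add_zero]

theorem glAction_diag {ρ : GLin m →* (V →L[ℝ] V)} {w : Fin m → ℝ} {v : V}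
    (hv : ∀ i, glAction ρ (Matrix.single i i 1) v = w i • v) {D : Matrix (Fin m) (Fin m) ℝ}
    (hD : D.IsDiag) : glAction ρ D v = (∑ i, w i * D i i) • v := by
  have h : D = ∑ i, D i i • Matrix.single i i (1 : ℝ) := by
    conv_lhs => rw [← hD.diagonal_diag]
    rw [← Matrix.sum_single_eq_diagonal]
    simp [Matrix.smul_single]
  conv_lhs => rw [h]
  simp only [map_sum, map_smul, LinearMap.sum_apply, LinearMap.smul_apply, hv, smul_smul,
    Finset.sum_smul, mul_comm]

theorem complexAct_tmul {ρ : GLin m →* (V →L[ℝ] V)} {w : Fin m → ℝ} {v : V}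
    (hv : ∀ i, glAction ρ (Matrix.single i i 1) v = w i • v) (H : cartan m) (z : ℂ) :
    complexAct ρ H.1.1 (z ⊗ₜ v) = weightOf (fun i => (w i : ℂ)) H • (z ⊗ₜ[ℝ] v) := by
  have h3 : complexAct ρ H.1.1 = (glAction ρ (H.1.1.map Complex.re)).baseChange ℂ
        + Complex.I • (glAction ρ (H.1.1.map Complex.im)).baseChange ℂ := rfl
  have hH : H.1.1.IsDiag := H.2
  rw [h3, LinearMap.add_apply, LinearMap.smul_apply, LinearMap.baseChange_tmul,
    LinearMap.baseChange_tmul, glAction_diag hv (hH.map Complex.zero_re),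
    glAction_diag hv (hH.map Complex.zero_im), ← TensorProduct.smul_tmul,
    ← TensorProduct.smul_tmul, TensorProduct.smul_tmul', TensorProduct.smul_tmul',
    ← TensorProduct.add_tmul, weightOf_apply]
  congr 1
  apply Complex.ext <;> simp [Finset.sum_mul, Finset.sum_add_distrib, sub_eq_add_neg]

/-- An irreducible representation has exactly one highest weight. -/
theorem isHighestWeight_iff [FiniteDimensional ℝ V] {ρ : GLin m →* (V →L[ℝ] V)} {c : ℝ}
    {β : LinearMap.BilinForm ℝ V} (h : IsContravariantRep (glAction ρ) c β)
    {N : Submodule ℝ V} (hN : IsGlIrreducible (glAction ρ) N) {w : Fin m → ℝ}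
    (hw : ∀ i, ∀ v ∈ highestSpace (glAction ρ) N,
      glAction ρ (Matrix.single i i 1) v = w i • v) (ν : Module.Dual ℂ (cartan m)) :
    IsHighestWeight ρ N ν ↔ ν = weightOf fun i => (w i : ℂ) := by
  constructor
  · rintro ⟨x, hxN, hx0, hxν, hx⟩
    have hmem := parts_mem hxN
    have hre : rePart V x ∈ highestSpace (glAction ρ) N := ⟨hmem.1, fun i j hij => by
      rw [← rePart_baseChange, ← complexAct_single, hx i j hij, map_zero]⟩
    have him : imPart V x ∈ highestSpace (glAction ρ) N := ⟨hmem.2, fun i j hij => by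
      rw [← imPart_baseChange, ← complexAct_single, hx i j hij, map_zero]⟩
    ext H
    -- Both parts are real highest weight vectors and diagonal matrices act on them by the same
    -- scalars, so `x` has the weight given by `w`.
    have h1 : complexAct ρ H.1.1 x = weightOf (fun i => (w i : ℂ)) H • x := by
      rw [← rePart_add_imPart x, map_add, complexAct_tmul (fun i => hw i _ hre),
        complexAct_tmul (fun i => hw i _ him), smul_add]
    exact smul_left_injective ℂ hx0 ((hxν H).symm.trans h1)
  · rintro rfl
    obtain ⟨v, hv, hv0⟩ := Submodule.exists_mem_ne_zero_of_ne_bot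
      (h.highestSpace_ne_bot hN.1 hN.2.1)
    refine ⟨(1 : ℂ) ⊗ₜ v, Submodule.tmul_mem_baseChange_of_mem 1 hv.1, fun h0 => hv0 ?_,
      fun H => complexAct_tmul (fun i => hw i v hv) H 1, fun i j hij => ?_⟩
    · have h1 := congrArg (rePart V) h0
      rw [rePart_tmul, map_zero, Complex.one_re, one_smul] at h1
      exact h1
    · rw [complexAct_single, LinearMap.baseChange_tmul, hv.2 i j hij, TensorProduct.tmul_zero]

/-- The sum of the weights is found by applying Id = ∑ E_ii to a nonzero highest weight vector. -/
theorem exists_weights [FiniteDimensional ℝ V] {R : Matrix (Fin m) (Fin m) ℝ →ₗ[ℝ] Module.End ℝ V}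
    {c : ℝ} {β : LinearMap.BilinForm ℝ V} (h : IsContravariantRep R c β)
    {N : Submodule ℝ V} (hN : IsGlIrreducible R N) : ∃ w : Fin m → ℝ, ∑ i, w i = c ∧
      ∀ i, ∀ v ∈ highestSpace R N, R (Matrix.single i i 1) v = w i • v := by
  have h1 : ∀ i : Fin m, ∃ t : ℝ, ∀ v ∈ highestSpace R N, R (Matrix.single i i 1) v = t • v := by
    intro i
    rw [← Matrix.diagonal_single]
    exact h.exists_weight hN _
  choose w hw using h1
  refine ⟨w, ?_, hw⟩
  obtain ⟨v, hv, hv0⟩ := Submodule.exists_mem_ne_zero_of_ne_bot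
    (h.highestSpace_ne_bot hN.1 hN.2.1)
  refine smul_left_injective ℝ hv0 ?_
  have h2 : (1 : Matrix (Fin m) (Fin m) ℝ) = ∑ i, Matrix.single i i 1 := by
    rw [Matrix.sum_single_one]
  have h3 := LinearMap.congr_fun h.one v
  rw [h2, map_sum, LinearMap.sum_apply] at h3
  simp only [hw _ v hv, ← Finset.sum_smul] at h3
  exact h3

end Complexification

/-! ### Lie derivatives along quadratic vector fields -/

section LieDerivative

variable {m : ℕ} {V : Type*} [NormedAddCommGroup V] [NormedSpace ℝ V]

/-- The Lie derivative of a `V`-valued function. -/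
def lieD (R : Endo m →L[ℝ] V →L[ℝ] V) (X : Vec m → Vec m) (T : Vec m → V) (x : Vec m) : V :=
  fderiv ℝ T x (X x) - R (fderiv ℝ X x) (T x)

/-- This is the product rule, kept for general smooth fields; the second derivative of `Y` is
retained because it is nonzero for quadratic fields. -/
theorem lieD_lieD (R : Endo m →L[ℝ] V →L[ℝ] V) (X Y : Vec m → Vec m) {T : Vec m → V}
    (hT : ContDiff ℝ ∞ T) (hY : ContDiff ℝ ∞ Y) (x : Vec m) :
    lieD R X (lieD R Y T) x = fderiv ℝ (fderiv ℝ T) x (X x) (Y x)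
      + fderiv ℝ T x (fderiv ℝ Y x (X x)) - R (fderiv ℝ (fderiv ℝ Y) x (X x)) (T x)
      - R (fderiv ℝ Y x) (fderiv ℝ T x (X x))
      - R (fderiv ℝ X x) (fderiv ℝ T x (Y x) - R (fderiv ℝ Y x) (T x)) := by
  have h1 : HasFDerivAt T (fderiv ℝ T x) x := (hT.differentiable (by simp) x).hasFDerivAt
  have h2 : HasFDerivAt (fderiv ℝ T) (fderiv ℝ (fderiv ℝ T) x) x :=
    ((hT.fderiv_right (m := ∞) le_rfl).differentiable (by simp) x).hasFDerivAt
  have h3 : HasFDerivAt Y (fderiv ℝ Y x) x := (hY.differentiable (by simp) x).hasFDerivAt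
  have h4 : HasFDerivAt (fderiv ℝ Y) (fderiv ℝ (fderiv ℝ Y) x) x :=
    ((hY.fderiv_right (m := ∞) le_rfl).differentiable (by simp) x).hasFDerivAt
  have h5 := (h2.clm_apply h3).sub ((R.hasFDerivAt.comp x h4).clm_apply h1)
  have h6 : fderiv ℝ (lieD R Y T) x = _ := h5.fderiv
  rw [lieD, h6]
  simp only [lieD, sub_apply, add_apply, ContinuousLinearMap.comp_apply,
    ContinuousLinearMap.flip_apply, Function.comp_apply]
  abel

/-- The quadratic vector field `x ↦ -v - B x + ξ(x) x`. -/
def quadField (v : Vec m) (B : Endo m) (ξ : Vec m →L[ℝ] ℝ) (x : Vec m) : Vec m :=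
  -v - B x + ξ x • x

theorem contDiff_quadField (v : Vec m) (B : Endo m) (ξ : Vec m →L[ℝ] ℝ) :
    ContDiff ℝ ∞ (quadField v B ξ) :=
  (contDiff_const.sub B.contDiff).add (ξ.contDiff.smul contDiff_id)

theorem fderiv_quadField (v : Vec m) (B : Endo m) (ξ : Vec m →L[ℝ] ℝ) :
    fderiv ℝ (quadField v B ξ) = fun x => -B + (ξ x • 1 + ξ.smulRight x) := by
  funext x
  have h := (((hasFDerivAt_const (-v) x).sub B.hasFDerivAt).add
    ((ξ.hasFDerivAt (x := x)).smul (hasFDerivAt_id x))).fderiv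
  refine Eq.trans h ?_
  rw [zero_sub]
  rfl

theorem fderiv_fderiv_quadField (v : Vec m) (B : Endo m) (ξ : Vec m →L[ℝ] ℝ) (x u : Vec m) :
    fderiv ℝ (fderiv ℝ (quadField v B ξ)) x u = ξ u • 1 + ξ.smulRight u := by
  rw [fderiv_quadField]
  have h1 : HasFDerivAt (fun x : Vec m => -B + (ξ x • (1 : Endo m) + ξ.smulRight x))
      (ξ.smulRight (1 : Endo m) + ContinuousLinearMap.smulRightL ℝ (Vec m) (Vec m) ξ) x :=
    ((ξ.hasFDerivAt.smul_const (1 : Endo m)).add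
      (ContinuousLinearMap.smulRightL ℝ (Vec m) (Vec m) ξ).hasFDerivAt).const_add _
  rw [h1.fderiv]
  rfl

theorem sum_smul_apply_single {F : Type*} [NormedAddCommGroup F] [NormedSpace ℝ F]
    (f : Vec m →L[ℝ] F) (x : Vec m) : ∑ i, x i • f (Pi.single i 1) = f x := by
  conv_rhs => rw [pi_eq_sum_univ' x]
  simp [map_sum, Pi.single]

/-- The coordinate `x ↦ x i`. -/
abbrev coord (i : Fin m) : Vec m →L[ℝ] ℝ := ContinuousLinearMap.proj i

/-- The elementary endomorphism `E_{ij}`. -/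
abbrev elem (i j : Fin m) : Endo m := (coord j).smulRight (Pi.single i 1)

theorem smulRight_eq_sum_elem (i : Fin m) (x : Vec m) :
    (coord i).smulRight x = ∑ j, x j • elem j i := by
  ext u j
  simp [Pi.single_apply, mul_comm]

theorem sum_elem : ∑ i : Fin m, elem i i = (1 : Endo m) := by
  ext u j
  simp [Pi.single_apply]

/-- Write q and d for the second and first derivatives of T at x. The linear and Euler fields each
contribute q(x, x), and the two mixed sums each contribute its negative. The terms in d(x) are m and
1 against -(m+1). The terms where R meets d cancel as well: those with E_ij against the rank-one
part of the derivative of x_i x, those with Id against its scalar part. Only the terms in T(x)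
survive; (m+1) R(Id) comes from the second derivative of x_i x along -e_i, summed over i. -/
theorem casimir_lieD (R : Endo m →L[ℝ] V →L[ℝ] V) {T : Vec m → V} (hT : ContDiff ℝ ∞ T)
    (x : Vec m) :
    ∑ i, ∑ j, lieD R (quadField 0 (elem i j) 0) (lieD R (quadField 0 (elem j i) 0) T) x
      + lieD R (quadField 0 (-1) 0) (lieD R (quadField 0 (-1) 0) T) x
      + ∑ i, lieD R (quadField (Pi.single i 1) 0 0) (lieD R (quadField 0 0 (coord i)) T) x
      + ∑ i, lieD R (quadField 0 0 (coord i)) (lieD R (quadField (Pi.single i 1) 0 0) T) x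
    = ∑ i, ∑ j, R (elem i j) (R (elem j i) (T x)) + R 1 (R 1 (T x))
      + ((m : ℝ) + 1) • R 1 (T x) := by
  set q := fderiv ℝ (fderiv ℝ T) x with hq0
  set d := fderiv ℝ T x with hd0
  set t := T x with ht0
  have expand := fun v B ξ v' B' ξ' => lieD_lieD R (quadField v B ξ) (quadField v' B' ξ') hT
    (contDiff_quadField _ _ _) x
  simp only [fderiv_fderiv_quadField] at expand
  simp only [fderiv_quadField, ← hq0, ← hd0, ← ht0] at expand
  have T1 : ∀ i j, lieD R (quadField 0 (elem i j) 0) (lieD R (quadField 0 (elem j i) 0) T) x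
      = x j • x i • q (Pi.single i 1) (Pi.single j 1) + x j • d (Pi.single j 1)
        - x j • R (elem j i) (d (Pi.single i 1)) - x i • R (elem i j) (d (Pi.single j 1))
        + R (elem i j) (R (elem j i) t) := by
    intro i j
    rw [expand]
    simp [quadField]
    abel
  have T2 : lieD R (quadField 0 (-1) 0) (lieD R (quadField 0 (-1) 0) T) x
      = q x x + d x - (2 : ℝ) • R 1 (d x) + R 1 (R 1 t) := by
    rw [expand]
    simp [quadField, two_smul]
    abel
  have T3 : ∀ i, lieD R (quadField (Pi.single i 1) 0 0) (lieD R (quadField 0 0 (coord i)) T) x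
      = -(x i • q (Pi.single i 1) x) - d x - x i • d (Pi.single i 1)
        + R (elem i i) t + R 1 t + R ((coord i).smulRight x) (d (Pi.single i 1))
        + x i • R 1 (d (Pi.single i 1)) := by
    intro i
    have hneg : (coord i).smulRight (-(Pi.single i 1 : Vec m)) = -elem i i := by ext; simp
    rw [expand]
    simp [quadField, hneg]
    abel
  have T4 : ∀ i, lieD R (quadField 0 0 (coord i)) (lieD R (quadField (Pi.single i 1) 0 0) T) x
      = -(x i • q x (Pi.single i 1)) + R ((coord i).smulRight x) (d (Pi.single i 1))
        + x i • R 1 (d (Pi.single i 1)) := by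
    intro i
    rw [expand]
    simp [quadField]
    abel
  have hq1 : ∑ i, x i • q (Pi.single i 1) x = q x x :=
    sum_smul_apply_single (q.flip x) x
  have hq2 : ∑ i, x i • q x (Pi.single i 1) = q x x := sum_smul_apply_single (q x) x
  have hq : ∑ i, ∑ j, x j • x i • q (Pi.single i 1) (Pi.single j 1) = q x x := by
    rw [← hq1]
    refine Finset.sum_congr rfl fun i _ => ?_
    rw [← sum_smul_apply_single (q (Pi.single i 1)) x, Finset.smul_sum]
    exact Finset.sum_congr rfl fun j _ => smul_comm _ _ _
  have hd : ∑ i, x i • d (Pi.single i 1) = d x := sum_smul_apply_single d x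
  have hR1 : ∑ i, x i • R 1 (d (Pi.single i 1)) = R 1 (d x) :=
    sum_smul_apply_single ((R 1).comp d) x
  -- The rank-one endomorphism u ↦ u_i x is expanded in elementary ones so that it matches the cross
  -- terms of the linear fields.
  have hQ2 : ∑ i, R ((coord i).smulRight x) (d (Pi.single i 1))
      = ∑ i, ∑ j, x j • R (elem j i) (d (Pi.single i 1)) := by
    refine Finset.sum_congr rfl fun i _ => ?_
    rw [smulRight_eq_sum_elem]
    simp
  have hQ3 : ∑ i, ∑ j, x i • R (elem i j) (d (Pi.single j 1))
      = ∑ i, ∑ j, x j • R (elem j i) (d (Pi.single i 1)) := Finset.sum_comm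
  have hRt : ∑ i : Fin m, R (elem i i) t = R 1 t := by
    rw [← sum_elem]; simp
  simp only [T1, T2, T3, T4, Finset.sum_add_distrib, Finset.sum_sub_distrib,
    Finset.sum_neg_distrib, hq, hq1, hq2, hd, hR1, hQ2, hQ3, hRt, Finset.sum_const,
    Finset.card_univ, Fintype.card_fin]
  module

end LieDerivative

/-! ### Casimir elements of `sl(n)` -/

/-- The projection of `gl(n)` onto `sl(n)` along the scalar matrices. -/
def slProj {ι : Type*} [Fintype ι] [DecidableEq ι] [Nonempty ι] (M : Matrix ι ι ℝ) : sl ι ℝ :=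
  ⟨M - (M.trace / Fintype.card ι) • 1, by
    have h : (Fintype.card ι : ℝ) ≠ 0 := by simp
    change Matrix.trace _ = 0
    rw [Matrix.trace_sub, Matrix.trace_smul, Matrix.trace_one, smul_eq_mul, div_mul_cancel₀ _ h,
      sub_self]⟩

/-- The projected elementary matrices are linearly dependent but still span; the corrections add up
to a multiple of the trace, which is zero. -/
theorem sum_smul_slProj_single {ι : Type*} [Fintype ι] [DecidableEq ι] [Nonempty ι] (y : sl ι ℝ) :
    ∑ a, ∑ b, y.1 a b • slProj (Matrix.single a b 1) = y := by
  refine Subtype.ext ?_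
  have hy : y.1.trace = 0 := y.2
  have h1 : ((∑ a, ∑ b, y.1 a b • slProj (Matrix.single a b 1) : sl ι ℝ) : Matrix ι ι ℝ)
      = ∑ a, ∑ b, y.1 a b • (slProj (Matrix.single a b 1)).1 := by
    rw [AddSubmonoidClass.coe_finsetSum]
    exact Finset.sum_congr rfl fun a _ => by rw [AddSubmonoidClass.coe_finsetSum]; rfl
  have h2 : y.1 = ∑ a, ∑ b, y.1 a b • Matrix.single a b (1 : ℝ) := by
    conv_lhs => rw [Matrix.matrix_eq_sum_single y.1]
    simp [Matrix.smul_single]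
  have h3 : ∑ a, ∑ b, y.1 a b * (Matrix.single a b (1 : ℝ)).trace = 0 := by
    rw [← hy]
    nth_rewrite 2 [h2]
    simp only [Matrix.trace_sum, Matrix.trace_smul, smul_eq_mul]
  rw [h1]
  simp only [slProj, smul_sub, Finset.sum_sub_distrib, ← h2, smul_smul, ← Finset.sum_smul,
    mul_div_assoc', ← Finset.sum_div, h3]
  simp

/-- The Casimir element of `sl(n)` in terms of elementary matrices. -/
theorem sum_mul_dualBasis {κ W ι : Type*} [Fintype ι] [DecidableEq ι] [Nonempty ι]
    [Fintype κ] [DecidableEq κ] [AddCommGroup W] [Module ℝ W] (P : sl ι ℝ →ₗ[ℝ] Module.End ℝ W)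
    (b : Module.Basis κ ℝ (sl ι ℝ)) :
    ∑ i, P (b i) * P ((killingForm ℝ (sl ι ℝ)).dualBasis (slKillingForm_nondegenerate ℝ _) b i)
      = (2 * (Fintype.card ι : ℝ))⁻¹ • ∑ a, ∑ c,
        P (slProj (Matrix.single a c 1)) * P (slProj (Matrix.single c a 1)) := by
  set b' := (killingForm ℝ (sl ι ℝ)).dualBasis (slKillingForm_nondegenerate ℝ _) b with hb'
  have hn : (2 * (Fintype.card ι : ℝ)) ≠ 0 := by simp
  -- Pairing with the dual basis reads off coordinates in `b`. Applied to a projected elementary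
  -- matrix this yields an entry of `b' i`, since pairing with a trace-free matrix ignores the
  -- scalar correction.
  have hrepr : ∀ (h : sl ι ℝ) i, killingForm ℝ (sl ι ℝ) (b' i) h = b.repr h i := by
    intro h i
    conv_lhs => rw [← b.sum_repr h]
    simp only [map_sum, map_smul, smul_eq_mul, hb', LinearMap.BilinForm.apply_dualBasis_left]
    simp
  have hk : ∀ i a c, b.repr (slProj (Matrix.single a c 1)) i
      = 2 * (Fintype.card ι : ℝ) * (b' i).1 c a := by
    intro i a c
    have hy : (b' i).1.trace = 0 := (b' i).2
    rw [← hrepr, slKillingForm_apply, slProj, mul_sub, Matrix.trace_sub, mul_smul_comm, mul_one,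
      Matrix.trace_smul, hy, smul_zero, sub_zero, Matrix.trace_mul_single]
    simp
  have hP : ∀ a c, P (slProj (Matrix.single a c 1))
      = ∑ i, (2 * (Fintype.card ι : ℝ) * (b' i).1 c a) • P (b i) := by
    intro a c
    conv_lhs => rw [← b.sum_repr (slProj (Matrix.single a c 1))]
    simp only [map_sum, map_smul, hk]
  have h1 : ∑ a, ∑ c, P (slProj (Matrix.single a c 1)) * P (slProj (Matrix.single c a 1))
      = (2 * (Fintype.card ι : ℝ)) • ∑ i, P (b i) * P (b' i) := by
    rw [Finset.smul_sum]
    have h2 : ∀ i, P (b' i) = ∑ a, ∑ c, (b' i).1 c a • P (slProj (Matrix.single c a 1)) := by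
      intro i
      conv_lhs => rw [← sum_smul_slProj_single (b' i)]
      simp only [map_sum, map_smul]
      exact Finset.sum_comm
    have h3 : ∀ i, (2 * (Fintype.card ι : ℝ)) • (P (b i) * P (b' i)) = ∑ a, ∑ c,
        ((2 * (Fintype.card ι : ℝ) * (b' i).1 c a) • P (b i)) *
          P (slProj (Matrix.single c a 1)) := by
      intro i
      rw [h2 i]
      simp only [Finset.mul_sum, Finset.smul_sum, smul_mul_assoc, mul_smul_comm, smul_smul]
    simp only [h3]
    conv_rhs => rw [Finset.sum_comm]
    refine Finset.sum_congr rfl fun a _ => ?_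
    conv_rhs => rw [Finset.sum_comm]
    exact Finset.sum_congr rfl fun c _ => by rw [hP a c, Finset.sum_mul]
  rw [h1, smul_smul, inv_mul_cancel₀ hn, one_smul]

/-! ### The Casimir operator on symbols -/

section Casimir

variable {m : ℕ} {V₁ V₂ : Type*} [NormedAddCommGroup V₁] [NormedSpace ℝ V₁]
  [NormedAddCommGroup V₂] [NormedSpace ℝ V₂]

theorem projField_eq_quadField (h : sl (Fin m ⊕ Unit) ℝ) {v : Vec m} {B : Endo m}
    {ξ : Vec m →L[ℝ] ℝ} (hv : ∀ i, v i = h.1 (Sum.inl i) (Sum.inr ()))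
    (hB : ∀ x, B x = (h.1.toBlocks₁₁ - h.1 (Sum.inr ()) (Sum.inr ()) • 1) *ᵥ x)
    (hξ : ∀ x, ξ x = ∑ j, h.1 (Sum.inr ()) (Sum.inl j) * x j) :
    projField h = quadField v B ξ := by
  funext x
  rw [projField, quadField, hB, hξ, funext hv]

theorem slProj_single_apply (a b c d : Fin m ⊕ Unit) :
    (slProj (Matrix.single a b (1 : ℝ))).1 c d
      = (if a = c ∧ b = d then 1 else 0)
        - (Matrix.single a b (1 : ℝ)).trace / Fintype.card (Fin m ⊕ Unit) *
          (if c = d then 1 else 0) := by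
  simp [slProj, Matrix.single_apply, Matrix.one_apply]

/-- The field depends only on A - a Id and the off-diagonal blocks, so the scalar matrix subtracted
by `slProj` has no effect. -/
theorem projField_slProj_inl_inl (i j : Fin m) :
    projField (slProj (Matrix.single (Sum.inl i) (Sum.inl j) 1)) = quadField 0 (elem i j) 0 := by
  refine projField_eq_quadField _ (fun l => ?_) (fun x => ?_) fun x => ?_
  · rw [slProj_single_apply]; simp
  · ext l
    simp only [Matrix.mulVec, dotProduct, Matrix.sub_apply, Matrix.toBlocks₁₁, Matrix.of_apply,
      slProj_single_apply, Matrix.smul_apply, Matrix.one_apply]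
    by_cases hil : i = l <;>
      simp [sub_mul, Finset.sum_sub_distrib, hil, eq_comm]
  · simp [slProj_single_apply]

theorem projField_slProj_inl_inr (i : Fin m) :
    projField (slProj (Matrix.single (Sum.inl i) (Sum.inr ()) 1))
      = quadField (Pi.single i 1) 0 0 := by
  refine projField_eq_quadField _ (fun l => ?_) (fun x => ?_) fun x => ?_
  · rw [slProj_single_apply]; simp [Pi.single_apply, eq_comm]
  · ext l
    simp [Matrix.mulVec, dotProduct, Matrix.sub_apply, Matrix.toBlocks₁₁, Matrix.of_apply,
      slProj_single_apply]
  · simp [slProj_single_apply]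

theorem projField_slProj_inr_inl (i : Fin m) :
    projField (slProj (Matrix.single (Sum.inr ()) (Sum.inl i) 1))
      = quadField 0 0 (coord i) := by
  refine projField_eq_quadField _ (fun l => ?_) (fun x => ?_) fun x => ?_
  · rw [slProj_single_apply]; simp
  · ext l
    simp [Matrix.mulVec, dotProduct, Matrix.sub_apply, Matrix.toBlocks₁₁, Matrix.of_apply,
      slProj_single_apply]
  · simp [slProj_single_apply]

/-- The corner entry enters through -a Id, whence the Euler field. -/
theorem projField_slProj_inr_inr :
    projField (slProj (Matrix.single (Sum.inr ()) (Sum.inr ()) 1))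
      = quadField (0 : Vec m) (-1) 0 := by
  refine projField_eq_quadField _ (fun l => ?_) (fun x => ?_) fun x => ?_
  · rw [slProj_single_apply]; simp
  · ext l
    simp only [Matrix.mulVec, dotProduct, Matrix.sub_apply, Matrix.toBlocks₁₁, Matrix.of_apply,
      slProj_single_apply, Matrix.smul_apply, Matrix.one_apply]
    simp [sub_mul]
    ring
  · simp [slProj_single_apply]

variable (ρ₁ : GLin m →* (V₁ →L[ℝ] V₁)) (ρ₂ : GLin m →* (V₂ →L[ℝ] V₂)) (k : ℕ)

/-- The action `h ↦ L_{X^h}` of `sl(m + 1, ℝ)` on symbols of degree `k`. -/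
def projActDeg : sl (Fin m ⊕ Unit) ℝ →ₗ[ℝ] Module.End ℝ (SymbolsDeg m V₁ V₂ k) where
  toFun h := lieDerivDeg ρ₁ ρ₂ (projField h) (contDiff_projField h) k
  map_add' h h' := by
    ext T : 1
    refine Subtype.ext (funext fun x => ?_)
    have e : projField (h + h') = projField h + projField h' := by
      funext x
      have : (h + h').1 = h.1 + h'.1 := rfl
      ext i
      simp only [projField, this, Pi.add_apply, Matrix.add_apply, Matrix.mulVec, dotProduct,
        Pi.sub_apply, Pi.neg_apply, Matrix.sub_apply, Matrix.toBlocks₁₁, Matrix.of_apply,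
        Matrix.smul_apply, Pi.smul_apply, smul_eq_mul, add_mul, sub_mul, Finset.sum_add_distrib,
        Finset.sum_sub_distrib]
      ring
    change lieD _ (projField (h + h')) T.1 x
      = lieD _ (projField h) T.1 x + lieD _ (projField h') T.1 x
    have e2 : fderiv ℝ (projField h + projField h') x
        = fderiv ℝ (projField h) x + fderiv ℝ (projField h') x :=
      fderiv_add ((contDiff_projField h).differentiable (by simp) x)
        ((contDiff_projField h').differentiable (by simp) x)
    simp only [lieD, e, e2, Pi.add_apply, map_add, add_apply]
    abel
  map_smul' t h := by
    ext T : 1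
    refine Subtype.ext (funext fun x => ?_)
    have e : projField (t • h) = t • projField h := by
      funext x
      have : (t • h).1 = t • h.1 := rfl
      ext i
      simp only [projField, this, Pi.add_apply, Matrix.mulVec, dotProduct,
        Pi.sub_apply, Pi.neg_apply, Matrix.sub_apply, Matrix.toBlocks₁₁, Matrix.of_apply,
        Matrix.smul_apply, Pi.smul_apply, smul_eq_mul, sub_mul, mul_assoc,
        Finset.sum_sub_distrib, ← Finset.mul_sum]
      ring
    change lieD _ (projField (t • h)) T.1 x = t • lieD _ (projField h) T.1 x
    have e2 : fderiv ℝ (t • projField h) x = t • fderiv ℝ (projField h) x :=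
      fderiv_const_smul ((contDiff_projField h).differentiable (by simp) x) t
    simp only [lieD, e, e2, Pi.smul_apply, map_smul, smul_apply, smul_sub]

theorem projActDeg_apply (h : sl (Fin m ⊕ Unit) ℝ) (T : SymbolsDeg m V₁ V₂ k) :
    (projActDeg ρ₁ ρ₂ k h T).1 = lieD (diffRep (symbolRep ρ₁ ρ₂ k)) (projField h) T.1 := rfl

theorem projAct_inclDeg (h : sl (Fin m ⊕ Unit) ℝ) (T : SymbolsDeg m V₁ V₂ k) :
    projAct ρ₁ ρ₂ h (inclDeg m V₁ V₂ k T) = inclDeg m V₁ V₂ k (projActDeg ρ₁ ρ₂ k h T) :=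
  DirectSum.lmap_lof _ _ _

theorem casimir_inclDeg {ι : Type*} [Fintype ι] [DecidableEq ι]
    (b : Module.Basis ι ℝ (sl (Fin m ⊕ Unit) ℝ)) (T : SymbolsDeg m V₁ V₂ k) :
    casimir ρ₁ ρ₂ b (inclDeg m V₁ V₂ k T) = inclDeg m V₁ V₂ k
      ((∑ i, projActDeg ρ₁ ρ₂ k (b i) * projActDeg ρ₁ ρ₂ k
        ((killingForm ℝ (sl (Fin m ⊕ Unit) ℝ)).dualBasis
          (slKillingForm_nondegenerate ℝ _) b i)) T) := by
  simp only [casimir, LinearMap.sum_apply, Module.End.mul_apply, projAct_inclDeg, map_sum]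

theorem elem_eq_ofMatrix (i j : Fin m) : elem i j = ofMatrix (Matrix.single i j 1) := by
  ext u l
  simp [ofMatrix, Matrix.mulVec, dotProduct, Pi.single_apply, Matrix.single_apply, ite_and,
    eq_comm]

/-- The Casimir operator acts on symbols of degree `k` by an operator of order zero. -/
theorem casimirDeg_apply {ι : Type*} [Fintype ι] [DecidableEq ι]
    (b : Module.Basis ι ℝ (sl (Fin m ⊕ Unit) ℝ)) (T : SymbolsDeg m V₁ V₂ k) (x : Vec m) :
    ((∑ i, projActDeg ρ₁ ρ₂ k (b i) * projActDeg ρ₁ ρ₂ k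
        ((killingForm ℝ (sl (Fin m ⊕ Unit) ℝ)).dualBasis
          (slKillingForm_nondegenerate ℝ _) b i)) T).1 x
      = (2 * ((m : ℝ) + 1))⁻¹ • (glCasimir (glAction (symbolRep ρ₁ ρ₂ k)) (T.1 x)
        + diffRep (symbolRep ρ₁ ρ₂ k) 1 (diffRep (symbolRep ρ₁ ρ₂ k) 1 (T.1 x))
        + ((m : ℝ) + 1) • diffRep (symbolRep ρ₁ ρ₂ k) 1 (T.1 x)) := by
  have hcoe : ∀ {κ : Type} (s : Finset κ) (f : κ → SymbolsDeg m V₁ V₂ k),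
      (∑ i ∈ s, f i).1 x = ∑ i ∈ s, (f i).1 x := by
    intro κ s f
    rw [AddSubmonoidClass.coe_finsetSum, Finset.sum_apply]
  have hcard : (Fintype.card (Fin m ⊕ Unit) : ℝ) = m + 1 := by simp
  have hT : ContDiff ℝ ∞ T.1 := T.2
  have key := casimir_lieD (diffRep (symbolRep ρ₁ ρ₂ k)) hT x
  rw [sum_mul_dualBasis, hcard, LinearMap.smul_apply]
  have hsmul : ∀ (r : ℝ) (U : SymbolsDeg m V₁ V₂ k), (r • U).1 x = r • U.1 x := fun _ _ => rfl
  rw [hsmul]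
  congr 1
  simp only [LinearMap.sum_apply, Module.End.mul_apply, hcoe, projActDeg_apply]
  simp only [Fintype.sum_sum_type, Finset.sum_add_distrib, Finset.univ_unique, Finset.sum_singleton,
    PUnit.default_eq_unit, projField_slProj_inl_inl, projField_slProj_inl_inr,
    projField_slProj_inr_inl, projField_slProj_inr_inr]
  simp only [glCasimir, LinearMap.sum_apply, Module.End.mul_apply, glAction_apply,
    ← elem_eq_ofMatrix]
  rw [← key]
  abel

end Casimir

/-! ### Transposition in `GL(m, ℝ)` -/

section Transpose

variable {m : ℕ}

theorem ofMatrix_mul (A B : Matrix (Fin m) (Fin m) ℝ) :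
    ofMatrix (A * B) = ofMatrix A * ofMatrix B := by
  ext x : 1
  simp [ofMatrix, Matrix.toLin'_mul]

theorem ofMatrix_one : ofMatrix (1 : Matrix (Fin m) (Fin m) ℝ) = 1 := by
  ext x : 1
  simp [ofMatrix]

/-- The matrix of an endomorphism of `ℝ^m`. -/
def toMat (a : Endo m) : Matrix (Fin m) (Fin m) ℝ := LinearMap.toMatrix' (a : Vec m →ₗ[ℝ] Vec m)

theorem toMat_ofMatrix (A : Matrix (Fin m) (Fin m) ℝ) : toMat (ofMatrix A) = A := by
  simp [ofMatrix, toMat]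

theorem toMat_mul (a b : Endo m) : toMat (a * b) = toMat a * toMat b :=
  LinearMap.toMatrix'_mul _ _

theorem toMat_one : toMat (1 : Endo m) = 1 := LinearMap.toMatrix'_one

theorem toMat_apply (a : Endo m) (i j : Fin m) : toMat a i j = a (Pi.single j 1) i := by
  simp [toMat, LinearMap.toMatrix'_apply]

/-- The transpose of an invertible endomorphism of `ℝ^m`. -/
def glTranspose (a : GLin m) : GLin m where
  val := ofMatrix (toMat (a : Endo m))ᵀ
  inv := ofMatrix (toMat ((a⁻¹ : GLin m) : Endo m))ᵀ
  val_inv := by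
    rw [← ofMatrix_mul, ← Matrix.transpose_mul, ← toMat_mul, Units.inv_mul, toMat_one,
      Matrix.transpose_one, ofMatrix_one]
  inv_val := by
    rw [← ofMatrix_mul, ← Matrix.transpose_mul, ← toMat_mul, Units.mul_inv, toMat_one,
      Matrix.transpose_one, ofMatrix_one]

theorem glTranspose_inv (a : GLin m) : (glTranspose a)⁻¹ = glTranspose a⁻¹ := Units.ext rfl

theorem toMat_glTranspose (a : GLin m) :
    toMat (glTranspose a : Endo m) = (toMat (a : Endo m))ᵀ := toMat_ofMatrix _

theorem det_eq_toMat (a : Endo m) : a.det = (toMat a).det := (LinearMap.det_toMatrix' _).symm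

/-- `extRep` is multiplicative only on units; openness of GL(m) lets curves through 1 be
differentiated there. -/
theorem eventually_isUnit {γ : ℝ → Endo m} (hγ : ContinuousAt γ 0) (h0 : γ 0 = 1) :
    ∀ᶠ s in nhds (0 : ℝ), IsUnit (γ s) := by
  refine hγ.eventually (p := IsUnit) ?_
  rw [h0]
  exact Units.isOpen.mem_nhds isUnit_one

end Transpose

/-! ### Differentiable representations of `GL(m, ℝ)` -/

section Differential

variable {m : ℕ} {V : Type*} [NormedAddCommGroup V] [NormedSpace ℝ V]

/-- The extension by zero of a representation of `GL(m, ℝ)` to `gl(m, ℝ)`. -/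
def extRep (ρ : GLin m →* (V →L[ℝ] V)) : Endo m → V →L[ℝ] V :=
  Function.extend (Units.val : GLin m → Endo m) ρ 0

theorem extRep_val (ρ : GLin m →* (V →L[ℝ] V)) (a : GLin m) : extRep ρ (a : Endo m) = ρ a :=
  Units.val_injective.extend_apply _ _ _

theorem extRep_one (ρ : GLin m →* (V →L[ℝ] V)) : extRep ρ 1 = 1 := by
  rw [← Units.val_one, extRep_val, map_one]

/-- A representation of `GL(m, ℝ)`, differentiable at the identity, in which the homothety of
ratio `s` acts by a scalar whose derivative at `s = 1` is `c`, with an inner product for which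
the adjoint of the action of `a` is the action of its transpose. -/
structure IsContravariantGroupRep (ρ : GLin m →* (V →L[ℝ] V)) (c : ℝ)
    (β : LinearMap.BilinForm ℝ V) : Prop where
  inner : IsInnerForm β
  adj : ∀ a u v, β (ρ a u) v = β u (ρ (glTranspose a) v)
  diff : DifferentiableAt ℝ (extRep ρ) 1
  scalar : ∃ φ : ℝ → ℝ, φ 1 = 1 ∧ HasDerivAt φ c 1 ∧
    ∀ (s : ℝ) (a : GLin m), (a : Endo m) = s • 1 → ρ a = φ s • 1

theorem hasDerivAt_extRep {ρ : GLin m →* (V →L[ℝ] V)} (h : DifferentiableAt ℝ (extRep ρ) 1)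
    {γ : ℝ → Endo m} {A : Endo m} {t : ℝ} (hγ : HasDerivAt γ A t) (h0 : γ t = 1) :
    HasDerivAt (fun s => extRep ρ (γ s)) (diffRep ρ A) t := by
  have h1 : HasFDerivAt (extRep ρ) (diffRep ρ) (γ t) := by
    rw [h0]; exact h.hasFDerivAt
  exact h1.comp_hasDerivAt t hγ

theorem hasDerivAt_line (A : Endo m) : HasDerivAt (fun s : ℝ => 1 + s • A) A 0 := by
  simpa using ((hasDerivAt_id (0 : ℝ)).smul_const A).const_add 1

/-- Differentiate ρ(a(1 + sB)a⁻¹) = ρ(a) ρ(1 + sB) ρ(a⁻¹) at s = 0. -/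
theorem diffRep_conj {ρ : GLin m →* (V →L[ℝ] V)} (h : DifferentiableAt ℝ (extRep ρ) 1)
    (a : GLin m) (B : Endo m) :
    diffRep ρ (a * B * (a⁻¹ : GLin m)) * ρ a = ρ a * diffRep ρ B := by
  have h1 : HasDerivAt (fun s : ℝ => (a : Endo m) * (1 + s • B) * (a⁻¹ : GLin m))
      (a * B * (a⁻¹ : GLin m)) 0 := ((hasDerivAt_line B).const_mul _).mul_const _
  have h2 := hasDerivAt_extRep h h1 (by simp)
  have h3 := ((hasDerivAt_extRep h (hasDerivAt_line B) (by simp)).const_mul (ρ a)).mul_const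
    (ρ a⁻¹)
  have h4 : (fun s : ℝ => extRep ρ ((a : Endo m) * (1 + s • B) * (a⁻¹ : GLin m)))
      =ᶠ[nhds 0] fun s => ρ a * extRep ρ (1 + s • B) * ρ a⁻¹ := by
    filter_upwards [eventually_isUnit (hasDerivAt_line B).continuousAt (by simp)] with s hs
    obtain ⟨b, hb⟩ := hs
    rw [← hb, ← Units.val_mul, ← Units.val_mul, extRep_val, extRep_val, map_mul, map_mul]
  have h5 := h2.unique (h3.congr_of_eventuallyEq h4)
  rw [h5, mul_assoc, ← map_mul, inv_mul_cancel, map_one, mul_one]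

/-- Differentiate the conjugation identity along a = 1 + sA. Having ρ(a) on the right of one side,
rather than ρ(a⁻¹) on the other, means that differentiability at 1 suffices and no derivative of an
inverse operator is needed. -/
theorem diffRep_bracket {ρ : GLin m →* (V →L[ℝ] V)} (h : DifferentiableAt ℝ (extRep ρ) 1)
    (A B : Endo m) :
    diffRep ρ (A * B - B * A) = diffRep ρ A * diffRep ρ B - diffRep ρ B * diffRep ρ A := by
  have hA := hasDerivAt_line A
  have hinv : HasDerivAt (fun s : ℝ => Ring.inverse (1 + s • A)) (-A) 0 := by
    have h1 := hasFDerivAt_ringInverse (𝕜 := ℝ) (1 : GLin m)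
    rw [Units.val_one] at h1
    have h2 := HasFDerivAt.comp_hasDerivAt_of_eq (0 : ℝ) h1 hA (by simp)
    simpa [Function.comp_def] using h2
  have h1 : HasDerivAt (fun s : ℝ => (1 + s • A) * B * Ring.inverse (1 + s • A))
      (A * B - B * A) 0 := by
    have h := HasDerivAt.fun_mul (hA.mul_const B) hinv
    refine h.congr_deriv ?_
    simp only [zero_smul, add_zero, Ring.inverse_one, mul_one, one_mul, sub_eq_add_neg]
    exact congrArg _ (mul_neg B A)
  have h2 := ((diffRep ρ).hasFDerivAt.comp_hasDerivAt (0 : ℝ) h1).mul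
    (hasDerivAt_extRep h hA (by simp))
  have h3 := (hasDerivAt_extRep h hA (by simp)).mul_const (diffRep ρ B)
  have h4 : (fun s : ℝ => diffRep ρ ((1 + s • A) * B * Ring.inverse (1 + s • A))
      * extRep ρ (1 + s • A)) =ᶠ[nhds 0] fun s => extRep ρ (1 + s • A) * diffRep ρ B := by
    filter_upwards [eventually_isUnit hA.continuousAt (by simp)] with s hs
    obtain ⟨a, ha⟩ := hs
    rw [← ha, Ring.inverse_unit, extRep_val, diffRep_conj h]
  have h5 := HasDerivAt.unique h2 (h3.congr_of_eventuallyEq h4)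
  simp only [Function.comp_apply, zero_smul, add_zero, extRep_one, mul_one, one_mul,
    Ring.inverse_one] at h5
  exact eq_sub_of_add_eq h5

theorem IsContravariantGroupRep.diffRep_one {ρ : GLin m →* (V →L[ℝ] V)} {c : ℝ}
    {β : LinearMap.BilinForm ℝ V} (h : IsContravariantGroupRep ρ c β) :
    diffRep ρ 1 = c • 1 := by
  obtain ⟨φ, -, hφ, hs⟩ := h.scalar
  have h1 : HasDerivAt (fun s : ℝ => s • (1 : Endo m)) 1 1 := by
    simpa using (hasDerivAt_id (1 : ℝ)).smul_const (1 : Endo m)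
  have h2 := hasDerivAt_extRep h.diff h1 (one_smul _ _)
  have h3 : (fun s : ℝ => extRep ρ (s • (1 : Endo m))) =ᶠ[nhds 1] fun s => φ s • 1 := by
    filter_upwards [isOpen_ne.mem_nhds (one_ne_zero : (1 : ℝ) ≠ 0)] with s hs0
    have hu : IsUnit (s • (1 : Endo m)) := (isUnit_one).smul (Units.mk0 s hs0)
    obtain ⟨a, ha⟩ := hu
    rw [← ha, extRep_val, hs s a ha]
  exact h2.unique ((hφ.smul_const (1 : V →L[ℝ] V)).congr_of_eventuallyEq h3)

/-- The infinitesimal adjunction is the derivative at s = 0 of the one for the group along 1 + sA,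
whose transpose is 1 + sAᵀ. -/
theorem IsContravariantGroupRep.isContravariantRep [FiniteDimensional ℝ V]
    {ρ : GLin m →* (V →L[ℝ] V)} {c : ℝ} {β : LinearMap.BilinForm ℝ V}
    (h : IsContravariantGroupRep ρ c β) : IsContravariantRep (glAction ρ) c β where
  inner := h.inner
  bracket A B := by
    have h1 : ofMatrix (A * B - B * A)
        = ofMatrix A * ofMatrix B - ofMatrix B * ofMatrix A := by
      rw [← ofMatrix_mul, ← ofMatrix_mul]; simp [ofMatrix]
    ext v
    rw [glAction_apply, h1, diffRep_bracket h.diff]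
    rfl
  one := by
    ext v
    rw [glAction_apply, ofMatrix_one, h.diffRep_one]
    rfl
  adj A u v := by
    have hA := hasDerivAt_line (ofMatrix A)
    have hT := hasDerivAt_line (ofMatrix Aᵀ)
    let L₁ : V →L[ℝ] ℝ := LinearMap.toContinuousLinearMap (β.flip v)
    let L₂ : V →L[ℝ] ℝ := LinearMap.toContinuousLinearMap (β u)
    have h1 := L₁.hasFDerivAt.comp_hasDerivAt (0 : ℝ)
      ((hasDerivAt_extRep h.diff hA (by simp)).clm_apply (hasDerivAt_const 0 u))
    have h2 := L₂.hasFDerivAt.comp_hasDerivAt (0 : ℝ)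
      ((hasDerivAt_extRep h.diff hT (by simp)).clm_apply (hasDerivAt_const 0 v))
    have h3 : (fun s : ℝ => L₁ (extRep ρ (1 + s • ofMatrix A) u))
        =ᶠ[nhds 0] fun s => L₂ (extRep ρ (1 + s • ofMatrix Aᵀ) v) := by
      filter_upwards [eventually_isUnit hA.continuousAt (by simp)] with s hs
      obtain ⟨a, ha⟩ := hs
      have hta : 1 + s • ofMatrix Aᵀ = (glTranspose a : Endo m) := by
        change _ = ofMatrix (toMat (a : Endo m))ᵀ
        have e : 1 + s • ofMatrix A = ofMatrix (1 + s • A) := by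
          rw [← ofMatrix_one]; simp [ofMatrix]
        rw [ha, e, toMat_ofMatrix, ← ofMatrix_one]
        simp [ofMatrix]
      rw [← ha, hta, extRep_val, extRep_val]
      exact h.adj a u v
    have h4 := HasDerivAt.unique h1 (HasDerivAt.congr_of_eventuallyEq h2 h3)
    simp only [map_zero, add_zero] at h4
    exact h4

end Differential

/-! ### Inner products on tensors and homomorphisms -/

section TensorForm

variable {m : ℕ} {ι W : Type*} [Fintype ι] [NormedAddCommGroup W] [NormedSpace ℝ W]

/-- The component of a tensor with indices `f`. -/
def component (f : ι → Fin m) : Tensors m ι W →ₗ[ℝ] W where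
  toFun T := T.eval fun i => coord (f i)
  map_add' _ _ := rfl
  map_smul' _ _ := rfl

theorem eval_eq_sum_component [DecidableEq ι] (T : Tensors m ι W) (ξ : ι → Vec m →L[ℝ] ℝ) :
    T.eval ξ = ∑ f : ι → Fin m, (∏ i, ξ i (Pi.single (f i) 1)) • component f T := by
  let M : MultilinearMap ℝ (fun _ : ι => Vec m →L[ℝ] ℝ) W :=
    ContinuousMultilinearMap.toMultilinearMap
      (show ContinuousMultilinearMap ℝ (fun _ : ι => Vec m →L[ℝ] ℝ) W from T)
  have hξ : ξ = fun i => ∑ l, ξ i (Pi.single l 1) • coord l := by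
    funext i
    ext x
    simp only [sum_apply, smul_apply, smul_eq_mul,
      ContinuousLinearMap.proj_apply]
    rw [← sum_smul_apply_single (ξ i) x]
    exact Finset.sum_congr rfl fun l _ => mul_comm _ _
  have h1 : T.eval ξ = M fun i => ∑ l, ξ i (Pi.single l 1) • coord l := by
    rw [← hξ]; rfl
  rw [h1, M.map_sum]
  exact Finset.sum_congr rfl fun f _ => M.map_smul_univ _ _

theorem component_injective (T : Tensors m ι W) (h : ∀ f, component f T = 0) : T = 0 := by
  classical
  refine Tensors.ext fun ξ => ?_
  rw [eval_eq_sum_component]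
  simp only [h, smul_zero, Finset.sum_const_zero]
  rfl

instance [FiniteDimensional ℝ W] : FiniteDimensional ℝ (Tensors m ι W) :=
  FiniteDimensional.of_injective (LinearMap.pi fun f : ι → Fin m => component f)
    ((injective_iff_map_eq_zero _).2 fun T h => component_injective T fun f => congrFun h f)

/-- The bilinear form on tensors induced by a bilinear form on the coefficients and the standard
inner product of `ℝ^m`. -/
def tensorForm (ι : Type*) [Fintype ι] [DecidableEq ι] (β : LinearMap.BilinForm ℝ W) :
    LinearMap.BilinForm ℝ (Tensors m ι W) :=
  ∑ f : ι → Fin m, β.compl₁₂ (component f) (component f)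

theorem tensorForm_apply [DecidableEq ι] (β : LinearMap.BilinForm ℝ W) (T U : Tensors m ι W) :
    tensorForm ι β T U = ∑ f : ι → Fin m, β (component f T) (component f U) := by
  simp [tensorForm, LinearMap.sum_apply]

theorem IsInnerForm.tensorForm [DecidableEq ι] {β : LinearMap.BilinForm ℝ W}
    (hβ : IsInnerForm β) : IsInnerForm (tensorForm (m := m) ι β) where
  symm T U := by
    rw [tensorForm_apply, tensorForm_apply]
    exact Finset.sum_congr rfl fun f _ => hβ.symm _ _
  pos T hT := by
    rw [tensorForm_apply]
    have hnn : ∀ w, 0 ≤ β w w := fun w => by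
      by_cases h : w = 0
      · simp [h]
      · exact (hβ.pos w h).le
    obtain ⟨f, hf⟩ : ∃ f : ι → Fin m, component f T ≠ 0 := by
      by_contra! h
      exact hT (component_injective T h)
    exact Finset.sum_pos' (fun f _ => hnn _) ⟨f, Finset.mem_univ _, hβ.pos _ hf⟩

/-- In components `a` acts by products of its matrix entries; transposing exchanges the two
multi-indices, and the two sides differ by the order of summation. -/
theorem tensorForm_adj [DecidableEq ι] {β : LinearMap.BilinForm ℝ W} {Φ Φ' : W →ₗ[ℝ] W}
    (hΦ : ∀ u v, β (Φ u) v = β u (Φ' v)) (a : GLin m) {T U T' U' : Tensors m ι W}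
    (hT : ∀ ξ, T'.eval ξ = Φ (T.eval fun i => (ξ i).comp (a : Endo m)))
    (hU : ∀ ξ, U'.eval ξ = Φ' (U.eval fun i => (ξ i).comp (glTranspose a : Endo m))) :
    tensorForm ι β T' U = tensorForm ι β T U' := by
  have h1 : ∀ f, component f T' = ∑ g : ι → Fin m,
      (∏ i, toMat (a : Endo m) (f i) (g i)) • Φ (component g T) := by
    intro f
    change T'.eval _ = _
    rw [hT, eval_eq_sum_component, map_sum]
    simp only [map_smul, toMat_apply]
    rfl
  have h2 : ∀ f, component f U' = ∑ g : ι → Fin m,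
      (∏ i, toMat (a : Endo m) (g i) (f i)) • Φ' (component g U) := by
    intro f
    change U'.eval _ = _
    rw [hU, eval_eq_sum_component, map_sum]
    refine Finset.sum_congr rfl fun g _ => ?_
    rw [map_smul]
    congr 1
    refine Finset.prod_congr rfl fun i _ => ?_
    rw [← Matrix.transpose_apply (toMat (a : Endo m)), ← toMat_glTranspose, toMat_apply]
    rfl
  simp only [tensorForm_apply, h1, h2, map_sum, map_smul, LinearMap.sum_apply,
    LinearMap.smul_apply, hΦ]
  exact Finset.sum_comm

end TensorForm

section HomForm

variable {V₁ V₂ : Type*} [NormedAddCommGroup V₁] [NormedSpace ℝ V₁]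
  [NormedAddCommGroup V₂] [NormedSpace ℝ V₂] {n : ℕ}

/-- The Hilbert-Schmidt form on `Hom(V₁, V₂)` defined by a basis of `V₁` and a bilinear form on
`V₂`. -/
def homForm (e : Module.Basis (Fin n) ℝ V₁) (β : LinearMap.BilinForm ℝ V₂) :
    LinearMap.BilinForm ℝ (V₁ →L[ℝ] V₂) :=
  ∑ i, β.compl₁₂ (ContinuousLinearMap.apply ℝ V₂ (e i) : (V₁ →L[ℝ] V₂) →ₗ[ℝ] V₂)
    (ContinuousLinearMap.apply ℝ V₂ (e i) : (V₁ →L[ℝ] V₂) →ₗ[ℝ] V₂)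

theorem homForm_apply (e : Module.Basis (Fin n) ℝ V₁) (β : LinearMap.BilinForm ℝ V₂)
    (φ ψ : V₁ →L[ℝ] V₂) : homForm e β φ ψ = ∑ i, β (φ (e i)) (ψ (e i)) := by
  simp [homForm, LinearMap.sum_apply]

theorem IsInnerForm.homForm (e : Module.Basis (Fin n) ℝ V₁) {β : LinearMap.BilinForm ℝ V₂}
    (hβ : IsInnerForm β) : IsInnerForm (homForm e β) where
  symm φ ψ := by
    rw [homForm_apply, homForm_apply]
    exact Finset.sum_congr rfl fun f _ => hβ.symm _ _
  pos φ hφ := by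
    rw [homForm_apply]
    have hnn : ∀ w, 0 ≤ β w w := fun w => by
      by_cases h : w = 0
      · simp [h]
      · exact (hβ.pos w h).le
    obtain ⟨i, hi⟩ : ∃ i, φ (e i) ≠ 0 := by
      by_contra! h
      refine hφ (ContinuousLinearMap.coe_injective (e.ext fun i => ?_))
      simpa using h i
    exact Finset.sum_pos' (fun f _ => hnn _) ⟨i, Finset.mem_univ _, hβ.pos _ hi⟩

/-- Orthonormality of `e` is what turns the adjoint on V₁ into an adjoint for composition on the
right: both sides expand into the same double sum over the matrix of `S`. -/
theorem homForm_precomp {β₁ : LinearMap.BilinForm ℝ V₁} (hβ₁ : IsInnerForm β₁)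
    {e : Module.Basis (Fin n) ℝ V₁}
    (he : ∀ i j, β₁ (e i) (e j) = if i = j then 1 else 0) (β : LinearMap.BilinForm ℝ V₂)
    {S S' : V₁ →L[ℝ] V₁} (hS : ∀ u v, β₁ (S u) v = β₁ u (S' v)) (φ ψ : V₁ →L[ℝ] V₂) :
    homForm e β (φ.comp S) ψ = homForm e β φ (ψ.comp S') := by
  have hrepr : ∀ v i, e.repr v i = β₁ (e i) v := by
    intro v i
    conv_rhs => rw [← e.sum_repr v]
    simp only [map_sum, map_smul, he, smul_eq_mul]
    simp
  have hexp : ∀ v, v = ∑ i, β₁ (e i) v • e i := by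
    intro v
    conv_lhs => rw [← e.sum_repr v]
    simp only [hrepr]
  have h1 : ∀ i, φ (S (e i)) = ∑ j, β₁ (e j) (S (e i)) • φ (e j) := by
    intro i
    conv_lhs => rw [hexp (S (e i))]
    simp only [map_sum, map_smul]
  have h2 : ∀ i, ψ (S' (e i)) = ∑ j, β₁ (e i) (S (e j)) • ψ (e j) := by
    intro i
    conv_lhs => rw [hexp (S' (e i))]
    simp only [map_sum, map_smul]
    exact Finset.sum_congr rfl fun j _ => by rw [← hS, hβ₁.symm]
  simp only [homForm_apply, ContinuousLinearMap.comp_apply, h1, h2, map_sum, map_smul,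
    LinearMap.sum_apply, LinearMap.smul_apply]
  exact Finset.sum_comm

end HomForm

/-! ### Differentiability -/

section Differentiability

variable {E S T : Type*} [NormedAddCommGroup E] [NormedSpace ℝ E]
  [NormedAddCommGroup S] [NormedSpace ℝ S] [NormedAddCommGroup T] [NormedSpace ℝ T]

theorem differentiableAt_apply_comp (L : S →L[ℝ] T) {f : E → S} {x : E}
    (hf : DifferentiableAt ℝ f x) : DifferentiableAt ℝ (fun a => L (f a)) x :=
  L.differentiableAt.comp x hf

/-- Differentiability of a family of operators may be checked after composing with an
injection. -/
theorem differentiableAt_of_comp_injective [FiniteDimensional ℝ T]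
    {F : E → S →L[ℝ] S} {x : E} (J : S →L[ℝ] T) (hJ : Function.Injective J)
    (h : DifferentiableAt ℝ (fun a => J.comp (F a)) x) : DifferentiableAt ℝ F x := by
  obtain ⟨P, hP⟩ := LinearMap.exists_leftInverse_of_injective (J : S →ₗ[ℝ] T)
    (LinearMap.ker_eq_bot.2 hJ)
  let Q : T →L[ℝ] S := LinearMap.toContinuousLinearMap P
  have h1 : F = fun a => Q.comp (J.comp (F a)) := by
    funext a
    ext v
    exact (LinearMap.congr_fun hP (F a v)).symm
  rw [h1]
  exact (differentiableAt_const Q).clm_comp h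

variable {m : ℕ} {ι W : Type*} [Fintype ι] [NormedAddCommGroup W] [NormedSpace ℝ W]

theorem differentiable_compContinuousLinearMapL {ι E G H W : Type*} [Fintype ι]
    [NormedAddCommGroup E] [NormedSpace ℝ E]
    [NormedAddCommGroup G] [NormedSpace ℝ G] [NormedAddCommGroup H] [NormedSpace ℝ H]
    [NormedAddCommGroup W] [NormedSpace ℝ W] {f : E → G →L[ℝ] H} (hf : Differentiable ℝ f) :
    Differentiable ℝ fun a => (ContinuousMultilinearMap.compContinuousLinearMapL
      (fun _ : ι => f a) : ContinuousMultilinearMap ℝ (fun _ : ι => H) W →L[ℝ]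
        ContinuousMultilinearMap ℝ (fun _ : ι => G) W) := by
  have h := (ContinuousMultilinearMap.compContinuousLinearMapContinuousMultilinear ℝ
    (fun _ : ι => G) (fun _ : ι => H) W).contDiff (n := 1)
  exact (h.differentiable (by simp)).comp
    (differentiable_pi.2 fun _ : ι => hf)

theorem differentiable_tensorAct : Differentiable ℝ (tensorAct (m := m) ι W) := by
  have h1 : Differentiable ℝ fun a : Endo m =>
      (ContinuousLinearMap.precomp ℝ a : (Vec m →L[ℝ] ℝ) →L[ℝ] (Vec m →L[ℝ] ℝ)) :=
    (ContinuousLinearMap.compL ℝ (Vec m) (Vec m) ℝ).flip.differentiable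
  exact differentiable_compContinuousLinearMapL h1

theorem differentiable_det : Differentiable ℝ (fun a : Endo m => a.det) := by
  have h : (fun a : Endo m => a.det) = fun a => ∑ σ : Equiv.Perm (Fin m),
      ((Equiv.Perm.sign σ : ℤ) : ℝ) * ∏ i, a (Pi.single i 1) (σ i) := by
    funext a
    rw [det_eq_toMat, Matrix.det_apply']
    simp only [toMat_apply]
  rw [h]
  have h2 : ∀ i j : Fin m, Differentiable ℝ fun a : Endo m => a (Pi.single i 1) j := fun i j =>
    ((coord j).comp (ContinuousLinearMap.apply ℝ (Vec m) (Pi.single i 1))).differentiable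
  fun_prop

theorem det_one : (1 : Endo m).det = 1 := by
  rw [det_eq_toMat, toMat_one, Matrix.det_one]

theorem det_smul_one (s : ℝ) : (s • (1 : Endo m)).det = s ^ m := by
  have h : toMat (s • (1 : Endo m)) = s • 1 := by
    rw [← toMat_one]; simp [toMat]
  rw [det_eq_toMat, h, Matrix.det_smul, Matrix.det_one, mul_one, Fintype.card_fin]

/-- The differential at 1 depends only on the germ there, so `extRep` may be replaced by any
explicit formula valid on GL(m). -/
theorem extRep_eventuallyEq {V : Type*} [NormedAddCommGroup V] [NormedSpace ℝ V]
    (ρ : GLin m →* (V →L[ℝ] V)) {F : Endo m → V →L[ℝ] V} (hF : ∀ a : GLin m, ρ a = F a) :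
    extRep ρ =ᶠ[nhds 1] F := by
  filter_upwards [Units.isOpen.mem_nhds (isUnit_one (M := Endo m))] with a ha
  obtain ⟨u, rfl⟩ := ha
  rw [extRep_val, hF]

theorem comp_smul_one (ξ : Vec m →L[ℝ] ℝ) (s : ℝ) : ξ.comp (s • (1 : Endo m)) = s • ξ := by
  ext x
  simp

theorem eval_smul_univ (T : Tensors m ι W) (s : ℝ) (ξ : ι → Vec m →L[ℝ] ℝ) :
    (T.eval fun i => s • ξ i) = s ^ Fintype.card ι • T.eval ξ := by
  have h := ContinuousMultilinearMap.map_smul_univ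
    (show ContinuousMultilinearMap ℝ (fun _ : ι => Vec m →L[ℝ] ℝ) W from T) (fun _ => s) ξ
  rw [Finset.prod_const, Finset.card_univ] at h
  exact h

end Differentiability

/-! ### The representations on Young modules -/

section Young

variable {m : ℕ} {Y : YoungDiagram}

/-- The inclusion of the Young module in the tensors. -/
def youngIncl (m : ℕ) (Y : YoungDiagram) : YoungSpace m Y →L[ℝ] Tensors m Y.cells ℝ :=
  (youngModule m Y).subtypeL

theorem youngIncl_injective (m : ℕ) (Y : YoungDiagram) : Function.Injective (youngIncl m Y) :=
  Subtype.val_injective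

instance (m : ℕ) (Y : YoungDiagram) : FiniteDimensional ℝ (YoungSpace m Y) :=
  inferInstanceAs (FiniteDimensional ℝ (youngModule m Y))

/-- The inner product on the Young module. -/
def youngForm (m : ℕ) (Y : YoungDiagram) : LinearMap.BilinForm ℝ (YoungSpace m Y) :=
  (tensorForm (m := m) Y.cells (LinearMap.mul ℝ ℝ)).compl₁₂ (youngIncl m Y : YoungSpace m Y →ₗ[ℝ] _)
    (youngIncl m Y : YoungSpace m Y →ₗ[ℝ] _)

theorem IsInnerForm.comp_injective {V W : Type*} [AddCommGroup V] [Module ℝ V] [AddCommGroup W]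
    [Module ℝ W] {β : LinearMap.BilinForm ℝ W} (hβ : IsInnerForm β) (J : V →ₗ[ℝ] W)
    (hJ : Function.Injective J) : IsInnerForm (β.compl₁₂ J J) where
  symm _ _ := hβ.symm _ _
  pos _ hv := hβ.pos _ fun h => hv (hJ (h.trans (map_zero J).symm))

theorem isInnerForm_mul : IsInnerForm (LinearMap.mul ℝ ℝ) where
  symm u v := mul_comm u v
  pos _ hv := mul_self_pos.2 hv

theorem youngRep_contravariant (m : ℕ) (Y : YoungDiagram) (lam : ℝ) (z : ℤ) :
    ∃ c, IsContravariantGroupRep (youngRep m Y lam z) c (youngForm m Y) := by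
  -- The homothety s Id has determinant s^m and acts on each of the |Y| tensor factors by s.
  let φ : ℝ → ℝ := fun s => (|s ^ m| ^ lam * (s ^ m) ^ z) * s ^ Fintype.card Y.cells
  have hφ : DifferentiableAt ℝ φ 1 := by
    have h1 : DifferentiableAt ℝ (fun s : ℝ => s ^ m) 1 := by fun_prop
    have h2 : DifferentiableAt ℝ (fun s : ℝ => |s ^ m|) 1 := h1.abs (by simp)
    have h3 : DifferentiableAt ℝ (fun s : ℝ => |s ^ m| ^ lam) 1 := h2.rpow_const (by simp)
    have h4 : DifferentiableAt ℝ (fun s : ℝ => (s ^ m) ^ z) 1 := h1.zpow (by simp)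
    exact (h3.mul h4).mul (by fun_prop)
  refine ⟨deriv φ 1, ?_, ?_, ?_, φ, ?_, hφ.hasDerivAt, ?_⟩
  · exact (isInnerForm_mul.tensorForm).comp_injective _ (youngIncl_injective m Y)
  · intro a u v
    have hdet : (glTranspose a : Endo m).det = (a : Endo m).det := by
      rw [det_eq_toMat, det_eq_toMat, toMat_glTranspose, Matrix.det_transpose]
    have h1 : youngForm m Y (youngAct Y (a : Endo m) u) v
        = youngForm m Y u (youngAct Y (glTranspose a : Endo m) v) :=
      tensorForm_adj (Φ := LinearMap.id) (Φ' := LinearMap.id) (fun _ _ => rfl) a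
        (T := youngIncl m Y u) (U := youngIncl m Y v) (fun ξ => rfl) (fun ξ => rfl)
    change youngForm m Y ((|(a : Endo m).det| ^ lam * (a : Endo m).det ^ z) •
      youngAct Y (a : Endo m) u) v = youngForm m Y u ((|(glTranspose a : Endo m).det| ^ lam *
        (glTranspose a : Endo m).det ^ z) • youngAct Y (glTranspose a : Endo m) v)
    rw [hdet, map_smul, map_smul, LinearMap.smul_apply, h1]
  · have h0 : DifferentiableAt ℝ (youngAct (m := m) Y) 1 :=
      differentiableAt_of_comp_injective (youngIncl m Y) (youngIncl_injective m Y)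
        ((differentiable_tensorAct 1).clm_comp (differentiableAt_const (youngIncl m Y)))
    have h1 : DifferentiableAt ℝ (fun a : Endo m => a.det) 1 := differentiable_det 1
    have h2 : DifferentiableAt ℝ (fun a : Endo m => |a.det|) 1 := h1.abs (by simp [det_one])
    have h3 : DifferentiableAt ℝ (fun a : Endo m => |a.det| ^ lam) 1 :=
      h2.rpow_const (by simp [det_one])
    have h4 : DifferentiableAt ℝ (fun a : Endo m => a.det ^ z) 1 := h1.zpow (by simp [det_one])
    exact ((h3.mul h4).smul h0).congr_of_eventuallyEq
      (extRep_eventuallyEq (youngRep m Y lam z)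
        (F := fun a => (|a.det| ^ lam * a.det ^ z) • youngAct Y a) fun a => rfl)
  · simp [φ]
  · intro s a ha
    change (|(a : Endo m).det| ^ lam * (a : Endo m).det ^ z) • youngAct Y (a : Endo m) = _
    have h1 : youngAct Y (s • (1 : Endo m)) = s ^ Fintype.card Y.cells • 1 := by
      refine ContinuousLinearMap.ext fun u => youngIncl_injective m Y (Tensors.ext fun ξ => ?_)
      change ((youngIncl m Y u).eval fun i => (ξ i).comp (s • (1 : Endo m))) = _
      simp only [comp_smul_one]
      exact eval_smul_univ (youngIncl m Y u) s ξ
    rw [ha, det_smul_one, h1, smul_smul]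

/-- The Young module of a diagram with at most `m` rows is not zero. -/
theorem youngSpace_nontrivial (hY : Y.colLen 0 ≤ m) : Nontrivial (YoungSpace m Y) := by
  have hrow : ∀ c : Y.cells, c.1.1 < m := fun c => by
    have h1 : c.1 ∈ Y := c.2
    have h2 : c.1.1 < Y.colLen c.1.2 := YoungDiagram.mem_iff_lt_colLen.1 h1
    exact h2.trans_le ((Y.colLen_anti _ _ (Nat.zero_le _)).trans hY)
  let r : Y.cells → Fin m := fun c => ⟨c.1.1, hrow c⟩
  -- The test tensor puts e_r at each cell of row r; its symmetrization is evaluated on the matching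
  -- coordinate covectors.
  let T : Tensors m Y.cells ℝ :=
    (ContinuousMultilinearMap.mkPiAlgebra ℝ Y.cells ℝ).compContinuousLinearMap
      fun c => ContinuousLinearMap.apply ℝ ℝ (Pi.single (r c) 1)
  have hT : ∀ ξ, T.eval ξ = ∏ c, ξ c (Pi.single (r c) 1) := fun ξ => rfl
  have hval : (youngSymmetrizer m Y T).eval (fun c => coord (r c)) = (rowGroup Y).card := by
    have h1 : (youngSymmetrizer m Y T).eval (fun c => coord (r c))
        = ∑ p ∈ rowGroup Y, ∑ q ∈ colGroup Y, ((Equiv.Perm.sign q : ℤ) : ℝ) *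
          T.eval fun c => coord (r (p (q c))) := by
      let ev : Tensors m Y.cells ℝ →ₗ[ℝ] ℝ := component r
      change ev (youngSymmetrizer m Y T) = _
      simp only [youngSymmetrizer, LinearMap.sum_apply, map_sum, LinearMap.smul_apply, map_smul]
      rfl
    rw [h1, Finset.card_eq_sum_ones, Nat.cast_sum]
    refine Finset.sum_congr rfl fun p hp => ?_
    have hp' : ∀ c : Y.cells, (p c).1.1 = c.1.1 := (Finset.mem_filter.1 hp).2
    have hr : ∀ c, r (p c) = r c := fun c => Fin.ext (hp' c)
    rw [Finset.sum_eq_single 1]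
    · simp [hT, hr]
    -- A nontrivial column permutation moves some cell to another row, which makes a factor vanish.
    -- Row permutations change nothing, so each contributes 1 and the value is the order of the row
    -- group.
    · intro q hq hq1
      have hq' : ∀ c : Y.cells, (q c).1.2 = c.1.2 := (Finset.mem_filter.1 hq).2
      obtain ⟨c, hc⟩ : ∃ c, r (q c) ≠ r c := by
        by_contra! hcon
        refine hq1 (Equiv.ext fun c => Subtype.ext (Prod.ext ?_ (hq' c)))
        exact congrArg Fin.val (hcon c)
      rw [hT, Finset.prod_eq_zero (Finset.mem_univ c), mul_zero]
      simp [hr, hc]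
    · intro h
      exact absurd (Finset.mem_filter.2 ⟨Finset.mem_univ _, fun c => rfl⟩) h
  have hcard : ((rowGroup Y).card : ℝ) ≠ 0 := by
    rw [Nat.cast_ne_zero, Finset.card_ne_zero]
    exact ⟨1, Finset.mem_filter.2 ⟨Finset.mem_univ _, fun c => rfl⟩⟩
  let v : YoungSpace m Y := (⟨youngSymmetrizer m Y T, T, rfl⟩ : youngModule m Y)
  refine ⟨v, 0, fun h => hcard ?_⟩
  rw [← hval]
  have h1 : youngSymmetrizer m Y T = 0 := congrArg (youngIncl m Y) h
  rw [h1]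
  rfl

end Young

/-! ### The representation on symbols -/

section SymbolRep

variable {m : ℕ} {V₁ V₂ : Type*} [NormedAddCommGroup V₁] [NormedSpace ℝ V₁]
  [NormedAddCommGroup V₂] [NormedSpace ℝ V₂]

/-- The inclusion of symmetric tensors in tensors. -/
def symIncl (m : ℕ) (V₁ V₂ : Type*) [NormedAddCommGroup V₁] [NormedSpace ℝ V₁]
    [NormedAddCommGroup V₂] [NormedSpace ℝ V₂] (k : ℕ) :
    SymTensors m V₁ V₂ k →L[ℝ] Tensors m (Fin k) (V₁ →L[ℝ] V₂) :=
  (symTensors m V₁ V₂ k).subtypeL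

theorem symIncl_injective (k : ℕ) : Function.Injective (symIncl m V₁ V₂ k) :=
  Subtype.val_injective

instance [FiniteDimensional ℝ V₁] [FiniteDimensional ℝ V₂] (k : ℕ) :
    FiniteDimensional ℝ (SymTensors m V₁ V₂ k) :=
  inferInstanceAs (FiniteDimensional ℝ (symTensors m V₁ V₂ k))

/-- The operator `φ ↦ g ∘ φ ∘ f` on `Hom(V₁, V₂)`. -/
def homConj (f : V₁ →L[ℝ] V₁) (g : V₂ →L[ℝ] V₂) : (V₁ →L[ℝ] V₂) →L[ℝ] (V₁ →L[ℝ] V₂) :=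
  (ContinuousLinearMap.precomp V₂ f).comp (ContinuousLinearMap.postcomp V₁ g)

theorem differentiableAt_homConj {E : Type*} [NormedAddCommGroup E]
    [NormedSpace ℝ E] {f : E → V₁ →L[ℝ] V₁} {g : E → V₂ →L[ℝ] V₂} {x : E}
    (hf : DifferentiableAt ℝ f x) (hg : DifferentiableAt ℝ g x) :
    DifferentiableAt ℝ (fun a => homConj (f a) (g a)) x := by
  have h1 : DifferentiableAt ℝ (fun a =>
      (ContinuousLinearMap.precomp V₂ (f a) : (V₁ →L[ℝ] V₂) →L[ℝ] (V₁ →L[ℝ] V₂))) x :=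
    differentiableAt_apply_comp (S := V₁ →L[ℝ] V₁) (T := (V₁ →L[ℝ] V₂) →L[ℝ] (V₁ →L[ℝ] V₂))
      (ContinuousLinearMap.compL ℝ V₁ V₁ V₂).flip hf
  have h2 : DifferentiableAt ℝ (fun a =>
      (ContinuousLinearMap.postcomp V₁ (g a) : (V₁ →L[ℝ] V₂) →L[ℝ] (V₁ →L[ℝ] V₂))) x :=
    differentiableAt_apply_comp (S := V₂ →L[ℝ] V₂) (T := (V₁ →L[ℝ] V₂) →L[ℝ] (V₁ →L[ℝ] V₂))
      (ContinuousLinearMap.compL ℝ V₁ V₂ V₂) hg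
  exact h1.clm_comp h2

/-- The action of an operator on the coefficients of tensors. -/
def tensorPost (m : ℕ) (ι : Type*) {W : Type*} [Fintype ι] [NormedAddCommGroup W]
    [NormedSpace ℝ W] (Φ : W →L[ℝ] W) : Tensors m ι W →L[ℝ] Tensors m ι W :=
  ContinuousLinearMap.compContinuousMultilinearMapL ℝ (fun _ : ι => Vec m →L[ℝ] ℝ) W W Φ

theorem differentiableAt_tensorPost {ι E W : Type*} [Fintype ι] [NormedAddCommGroup W]
    [NormedSpace ℝ W] [NormedAddCommGroup E] [NormedSpace ℝ E] {Φ : E → W →L[ℝ] W} {x : E}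
    (hΦ : DifferentiableAt ℝ Φ x) : DifferentiableAt ℝ (fun a => tensorPost m ι (Φ a)) x :=
  differentiableAt_apply_comp (S := W →L[ℝ] W) (T := Tensors m ι W →L[ℝ] Tensors m ι W)
    (ContinuousLinearMap.compContinuousMultilinearMapL ℝ (fun _ : ι => Vec m →L[ℝ] ℝ) W W) hΦ

/-- Near 1 the inverse in the action on V₁^* is `Ring.inverse`, which is differentiable; the rest is
composition of bounded multilinear operations, checked inside the space of all tensors. -/
theorem differentiableAt_symbolRep [FiniteDimensional ℝ V₁] [FiniteDimensional ℝ V₂]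
    {ρ₁ : GLin m →* (V₁ →L[ℝ] V₁)} {ρ₂ : GLin m →* (V₂ →L[ℝ] V₂)}
    (h₁ : DifferentiableAt ℝ (extRep ρ₁) 1) (h₂ : DifferentiableAt ℝ (extRep ρ₂) 1) (k : ℕ) :
    DifferentiableAt ℝ (extRep (symbolRep ρ₁ ρ₂ k)) 1 := by
  have hinv : DifferentiableAt ℝ (fun a : Endo m => extRep ρ₁ (Ring.inverse a)) 1 := by
    have e1 : DifferentiableAt ℝ (extRep ρ₁) (Ring.inverse (1 : Endo m)) := by
      rw [Ring.inverse_one]; exact h₁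
    have e2 : DifferentiableAt ℝ (Ring.inverse : Endo m → Endo m) 1 :=
      (hasFDerivAt_ringInverse (𝕜 := ℝ) (1 : GLin m)).differentiableAt
    exact e1.comp (1 : Endo m) e2
  have hΦ := differentiableAt_tensorPost (m := m) (ι := Fin k)
    (differentiableAt_homConj hinv h₂)
  have hG := hΦ.clm_comp (differentiable_tensorAct (ι := Fin k) (W := V₁ →L[ℝ] V₂) (1 : Endo m))
  refine differentiableAt_of_comp_injective (symIncl m V₁ V₂ k) (symIncl_injective k) ?_
  refine (hG.clm_comp (differentiableAt_const (symIncl m V₁ V₂ k))).congr_of_eventuallyEq ?_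
  filter_upwards [Units.isOpen.mem_nhds (isUnit_one (M := Endo m))] with a ha
  obtain ⟨u, rfl⟩ := ha
  rw [extRep_val, Ring.inverse_unit, extRep_val, extRep_val]
  rfl

theorem symbolRep_smul_one {ρ₁ : GLin m →* (V₁ →L[ℝ] V₁)} {ρ₂ : GLin m →* (V₂ →L[ℝ] V₂)} (k : ℕ)
    {a : GLin m} {s t₁ t₂ : ℝ} (ha : (a : Endo m) = s • 1) (h₁ : ρ₁ a⁻¹ = t₁ • 1)
    (h₂ : ρ₂ a = t₂ • 1) : symbolRep ρ₁ ρ₂ k a = (s ^ k * (t₂ * t₁)) • 1 := by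
  refine ContinuousLinearMap.ext fun T => symIncl_injective k (Tensors.ext fun ξ =>
    ContinuousLinearMap.ext fun u => ?_)
  have e1 := eval_smul_univ (symIncl m V₁ V₂ k T) s ξ
  rw [Fintype.card_fin] at e1
  have e2 : ((symIncl m V₁ V₂ k T).eval fun i => (ξ i).comp (a : Endo m))
      = s ^ k • (symIncl m V₁ V₂ k T).eval ξ := by
    rw [ha, ← e1]
    simp only [comp_smul_one]
  have e3 : (symIncl m V₁ V₂ k (symbolRep ρ₁ ρ₂ k a T)).eval ξ u
      = ρ₂ a (((symIncl m V₁ V₂ k T).eval fun i => (ξ i).comp (a : Endo m)) (ρ₁ a⁻¹ u)) := rfl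
  have e4 : (symIncl m V₁ V₂ k (((s ^ k * (t₂ * t₁)) • 1 : _ →L[ℝ] _) T)).eval ξ u
      = (s ^ k * (t₂ * t₁)) • (symIncl m V₁ V₂ k T).eval ξ u := rfl
  rw [e3, e4, e2, h₁, h₂]
  generalize (symIncl m V₁ V₂ k T).eval ξ = φ
  have e5 : (t₂ • (1 : V₂ →L[ℝ] V₂)) ((s ^ k • φ) ((t₁ • (1 : V₁ →L[ℝ] V₁)) u))
      = t₂ • s ^ k • φ (t₁ • u) := rfl
  rw [e5, map_smul, smul_smul, smul_smul]
  congr 1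
  ring

/-- The form combines the standard one on ℝ^m, the Hilbert-Schmidt form on Hom(V₁, V₂) and
restriction to symmetric tensors. The scalar of the identity is k from the tensor factors, c₂ from
V₂ and -c₁ from the dual of V₁. -/
theorem symbolRep_contravariant [FiniteDimensional ℝ V₁] [FiniteDimensional ℝ V₂]
    {ρ₁ : GLin m →* (V₁ →L[ℝ] V₁)} {ρ₂ : GLin m →* (V₂ →L[ℝ] V₂)} {c₁ c₂ : ℝ}
    {β₁ : LinearMap.BilinForm ℝ V₁} {β₂ : LinearMap.BilinForm ℝ V₂}
    (h₁ : IsContravariantGroupRep ρ₁ c₁ β₁) (h₂ : IsContravariantGroupRep ρ₂ c₂ β₂) (k : ℕ) :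
    ∃ β, IsContravariantGroupRep (symbolRep ρ₁ ρ₂ k) (k - c₁ + c₂) β := by
  obtain ⟨e, he⟩ := h₁.inner.exists_orthonormal
  have hadj : ∀ (a : GLin m) φ ψ, homForm e β₂ (homAct ρ₁ ρ₂ a φ) ψ
      = homForm e β₂ φ (homAct ρ₁ ρ₂ (glTranspose a) ψ) := by
    intro a φ ψ
    have e1 : homForm e β₂ (homAct ρ₁ ρ₂ a φ) ψ
        = homForm e β₂ ((ρ₂ a).comp φ) (ψ.comp (ρ₁ (glTranspose a⁻¹))) :=
      homForm_precomp h₁.inner he β₂ (h₁.adj a⁻¹) _ _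
    rw [e1, homForm_apply, homForm_apply]
    refine Finset.sum_congr rfl fun i _ => (h₂.adj a _ _).trans ?_
    rw [← glTranspose_inv]
    rfl
  refine ⟨(tensorForm (m := m) (Fin k) (homForm e β₂)).compl₁₂
    (symIncl m V₁ V₂ k : SymTensors m V₁ V₂ k →ₗ[ℝ] _)
    (symIncl m V₁ V₂ k : SymTensors m V₁ V₂ k →ₗ[ℝ] _),
    ((h₂.inner.homForm e).tensorForm).comp_injective _ (symIncl_injective k), ?_,
    differentiableAt_symbolRep h₁.diff h₂.diff k, ?_⟩
  · intro a u v
    exact tensorForm_adj (Φ := (homAct ρ₁ ρ₂ a : (V₁ →L[ℝ] V₂) →ₗ[ℝ] (V₁ →L[ℝ] V₂)))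
      (Φ' := (homAct ρ₁ ρ₂ (glTranspose a) : (V₁ →L[ℝ] V₂) →ₗ[ℝ] (V₁ →L[ℝ] V₂)))
      (hadj a) a (T := symIncl m V₁ V₂ k u) (U := symIncl m V₁ V₂ k v) (fun ξ => rfl)
      (fun ξ => rfl)
  · obtain ⟨φ₁, h11, hd1, hs1⟩ := h₁.scalar
    obtain ⟨φ₂, h21, hd2, hs2⟩ := h₂.scalar
    refine ⟨fun s => s ^ k * (φ₂ s * φ₁ s⁻¹), by simp [h11, h21], ?_, ?_⟩
    · have e1 : HasDerivAt (fun s : ℝ => φ₁ s⁻¹) (-c₁) 1 := by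
        have e2 : HasDerivAt φ₁ c₁ (1 : ℝ)⁻¹ := by rwa [inv_one]
        simpa [Function.comp_def] using e2.comp (1 : ℝ) (hasDerivAt_inv one_ne_zero)
      refine ((hasDerivAt_pow k (1 : ℝ)).fun_mul (hd2.fun_mul e1)).congr_deriv ?_
      simp [h11, h21]
      ring
    · intro s a ha
      refine symbolRep_smul_one k ha (hs1 s⁻¹ a⁻¹ ?_) (hs2 s a ha)
      have e1 : (s • (1 : Endo m)) * (a⁻¹ : GLin m) = 1 := by rw [← ha, Units.mul_inv]
      rw [smul_mul_assoc, one_mul] at e1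
      by_cases h0 : s = 0
      -- An invertible zero homothety forces the endomorphism algebra to be trivial, so every
      -- equality in it holds.
      · have e3 : (0 : Endo m) = 1 := by rw [← e1, h0, zero_smul]
        have e4 : ∀ b : Endo m, b = 0 := fun b => by rw [← mul_one b, ← e3, mul_zero]
        rw [e4 (s⁻¹ • 1)]
        exact e4 _
      · rw [← e1, smul_smul, inv_mul_cancel₀ h0, one_smul]

end SymbolRep

/-! ### Irreducibility under `sl(m)` and `gl(m)` -/

section Irreducible

variable {m : ℕ} {V : Type*} [NormedAddCommGroup V] [NormedSpace ℝ V]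
  {ρ : GLin m →* (V →L[ℝ] V)} {c : ℝ} {β : LinearMap.BilinForm ℝ V}

/-- A matrix is its trace-free part plus a scalar one, and scalars act by scalars, preserving every
subspace. -/
theorem isSlInvariant_iff (hm : m ≠ 0) (h : IsContravariantRep (glAction ρ) c β)
    (N : Submodule ℝ V) : IsSlInvariant ρ N ↔ IsGlInvariant (glAction ρ) N := by
  refine ⟨fun hN A v hv => ?_, fun hN A v hv => hN A.1 v hv⟩
  have : Nonempty (Fin m) := Fin.pos_iff_nonempty.1 (Nat.pos_of_ne_zero hm)
  have h1 : A = (slProj A).1 + (A.trace / Fintype.card (Fin m)) • 1 := by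
    simp [slProj]
  rw [h1, map_add, map_smul, h.one, LinearMap.add_apply]
  exact N.add_mem (hN (slProj A) v hv) (N.smul_mem _ (N.smul_mem _ hv))

theorem isSlIrreducible_iff (hm : m ≠ 0) (h : IsContravariantRep (glAction ρ) c β)
    (N : Submodule ℝ V) : IsSlIrreducible ρ N ↔ IsGlIrreducible (glAction ρ) N := by
  simp only [IsSlIrreducible, IsGlIrreducible, isSlInvariant_iff hm h]

end Irreducible

/-! ### Decompositions of the space of symbols -/

/-- Subspaces are independent if each of them is fixed by an operator that vanishes on the
others. -/
theorem iSupIndep_of_projections {κ V W : Type*} [AddCommGroup V] [Module ℝ V] [AddCommGroup W]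
    [Module ℝ W] {E : κ → Submodule ℝ V} (Q : κ → V →ₗ[ℝ] W)
    (hQ : ∀ p, ∀ x ∈ E p, Q p x = 0 → x = 0) (hQ' : ∀ p q, q ≠ p → ∀ x ∈ E q, Q p x = 0) :
    iSupIndep E := by
  intro p
  rw [disjoint_iff_inf_le]
  rintro x ⟨hx, hx'⟩
  have hle : ⨆ q, ⨆ (_ : q ≠ p), E q ≤ LinearMap.ker (Q p) :=
    iSup₂_le fun q hq x hx => hQ' p q hq x hx
  exact hQ p x hx (hle hx')

section Projections

variable {V : Type*} [AddCommGroup V] [Module ℝ V] {n : ℕ} {I : Fin n → Submodule ℝ V}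

/-- The projection onto a summand of an internal direct sum. -/
def summandProj (h : DirectSum.IsInternal I) (s : Fin n) : V →ₗ[ℝ] V :=
  (I s).subtype ∘ₗ DirectSum.component ℝ (Fin n) (fun s => I s) s ∘ₗ
    (LinearEquiv.ofBijective (DirectSum.coeLinearMap I) h).symm.toLinearMap

theorem summandProj_mem (h : DirectSum.IsInternal I) (s : Fin n) (v : V) :
    summandProj h s v ∈ I s := Subtype.property _

theorem summandProj_apply_of_mem (h : DirectSum.IsInternal I) {s t : Fin n} {v : V}
    (hv : v ∈ I t) : summandProj h s v = if t = s then v else 0 := by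
  have h1 : (LinearEquiv.ofBijective (DirectSum.coeLinearMap I) h).symm v
      = DirectSum.lof ℝ (Fin n) (fun s => I s) t ⟨v, hv⟩ := by
    rw [LinearEquiv.symm_apply_eq]
    exact (DirectSum.coeLinearMap_lof I t ⟨v, hv⟩).symm
  change ((DirectSum.component ℝ (Fin n) (fun s => I s) s
    ((LinearEquiv.ofBijective (DirectSum.coeLinearMap I) h).symm v) : I s) : V) = _
  rw [h1]
  by_cases hts : t = s
  · subst hts
    rw [if_pos rfl, DirectSum.component.lof_self]
  · rw [if_neg hts, DirectSum.component.of, dif_neg hts]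
    rfl

theorem sum_summandProj (h : DirectSum.IsInternal I) (v : V) : ∑ s, summandProj h s v = v := by
  have hv : v ∈ ⨆ s, I s := by
    rw [h.submodule_iSup_eq_top]; exact Submodule.mem_top
  induction hv using Submodule.iSup_induction' with
  | mem t x hx => simp [summandProj_apply_of_mem h hx]
  | zero => simp
  | add x y _ _ hx hy => simp only [map_add, Finset.sum_add_distrib, hx, hy]

end Projections

section Decomposition

variable {m : ℕ} {V₁ V₂ : Type*} [NormedAddCommGroup V₁] [NormedSpace ℝ V₁]
  [NormedAddCommGroup V₂] [NormedSpace ℝ V₂]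

/-- The component of degree `k` of a symbol, as a function. -/
def symbolComponent (m : ℕ) (V₁ V₂ : Type*) [NormedAddCommGroup V₁] [NormedSpace ℝ V₁]
    [NormedAddCommGroup V₂] [NormedSpace ℝ V₂] (k : ℕ) :
    Symbols m V₁ V₂ →ₗ[ℝ] Vec m → SymTensors m V₁ V₂ k :=
  (SymbolsDeg m V₁ V₂ k).subtype ∘ₗ
    (DirectSum.component ℝ ℕ (fun k => SymbolsDeg m V₁ V₂ k) k :
      (⨁ k : ℕ, SymbolsDeg m V₁ V₂ k) →ₗ[ℝ] SymbolsDeg m V₁ V₂ k)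

theorem symbolComponent_inclDeg_self (k : ℕ) (T : SymbolsDeg m V₁ V₂ k) :
    symbolComponent m V₁ V₂ k (inclDeg m V₁ V₂ k T) = T.1 :=
  congrArg Subtype.val
    (DirectSum.component.lof_self ℝ k (M := fun k => SymbolsDeg m V₁ V₂ k) T)

theorem symbolComponent_inclDeg_of_ne {k l : ℕ} (h : l ≠ k) (T : SymbolsDeg m V₁ V₂ l) :
    symbolComponent m V₁ V₂ k (inclDeg m V₁ V₂ l T) = 0 := by
  have h1 := DirectSum.component.of ℝ k l (M := fun k => SymbolsDeg m V₁ V₂ k) T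
  rw [dif_neg h] at h1
  exact congrArg Subtype.val h1

theorem mem_sectionsOf {k : ℕ} {I : Submodule ℝ (SymTensors m V₁ V₂ k)} {S : Symbols m V₁ V₂} :
    S ∈ sectionsOf k I ↔ ∃ T : SymbolsDeg m V₁ V₂ k, (∀ x, T.1 x ∈ I) ∧ inclDeg m V₁ V₂ k T = S :=
  Iff.rfl

/-- Independence is detected pointwise, by taking the degree-k component at x and projecting to a
summand. For spanning, the pointwise projection of a smooth symbol is again smooth because the
projection is a fixed linear map in finite dimension. -/
theorem isInternal_sectionsOf [FiniteDimensional ℝ V₁] [FiniteDimensional ℝ V₂] {n : ℕ → ℕ}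
    {I : ∀ k, Fin (n k) → Submodule ℝ (SymTensors m V₁ V₂ k)}
    (hI : ∀ k, DirectSum.IsInternal (I k)) :
    DirectSum.IsInternal (fun p : Σ k, Fin (n k) => sectionsOf p.1 (I p.1 p.2)) := by
  rw [DirectSum.isInternal_submodule_iff_iSupIndep_and_iSup_eq_top]
  constructor
  · refine iSupIndep_of_projections (W := ∀ k, Vec m → SymTensors m V₁ V₂ k)
      (fun p => LinearMap.pi fun k => LinearMap.pi fun x =>
        -- Evaluations in all degrees are collected so that the target does not depend on `p`;
        -- degrees other than that of `p` get the zero map.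
        if h : k = p.1 then (summandProj (hI k) (h ▸ p.2)) ∘ₗ
          LinearMap.proj x ∘ₗ symbolComponent m V₁ V₂ k else 0) ?_ ?_
    · rintro ⟨k, s⟩ S hS h0
      obtain ⟨T, hT, rfl⟩ := mem_sectionsOf.1 hS
      have h1 : T = 0 := by
        refine Subtype.ext (funext fun x => ?_)
        have h2 := congrFun (congrFun h0 k) x
        simp only [LinearMap.pi_apply, dite_true, LinearMap.comp_apply, LinearMap.proj_apply,
          symbolComponent_inclDeg_self] at h2
        rw [summandProj_apply_of_mem (hI k) (hT x), if_pos rfl] at h2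
        exact h2
      rw [h1, map_zero]
    · rintro ⟨k, s⟩ ⟨l, t⟩ hne S hS
      obtain ⟨T, hT, rfl⟩ := mem_sectionsOf.1 hS
      funext j x
      simp only [LinearMap.pi_apply]
      split_ifs with hj
      · change j = k at hj
        subst hj
        simp only [LinearMap.comp_apply, LinearMap.proj_apply]
        by_cases hl : l = j
        · subst hl
          rw [symbolComponent_inclDeg_self, summandProj_apply_of_mem (hI l) (hT x),
            if_neg fun h => hne (by rw [← h])]
          rfl
        · rw [symbolComponent_inclDeg_of_ne hl, Pi.zero_apply, map_zero]
          rfl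
      · rfl
  · rw [eq_top_iff]
    rintro S -
    have hlof : ∀ k (T : SymbolsDeg m V₁ V₂ k), inclDeg m V₁ V₂ k T
        ∈ ⨆ p : Σ k, Fin (n k), sectionsOf p.1 (I p.1 p.2) := by
      intro k T
      have hT : ContDiff ℝ ∞ T.1 := T.2
      let Tproj : Fin (n k) → SymbolsDeg m V₁ V₂ k := fun s =>
        ⟨fun x => summandProj (hI k) s (T.1 x),
          (LinearMap.toContinuousLinearMap (summandProj (hI k) s)).contDiff.comp hT⟩
      have hsum : T = ∑ s, Tproj s := by
        refine Subtype.ext (funext fun x => ?_)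
        rw [AddSubmonoidClass.coe_finsetSum, Finset.sum_apply]
        exact (sum_summandProj (hI k) (T.1 x)).symm
      rw [hsum, map_sum]
      refine Submodule.sum_mem _ fun s _ => Submodule.mem_iSup_of_mem ⟨k, s⟩ ?_
      exact mem_sectionsOf.2 ⟨Tproj s, fun x => summandProj_mem (hI k) s _, rfl⟩
    induction S using DirectSum.induction_on with
    | zero => exact Submodule.zero_mem _
    | of k T => exact hlof k T
    | add x y hx hy => exact Submodule.add_mem _ hx hy

/-- The Casimir operator acts by a scalar on the sections of an irreducible subspace. -/
theorem casimir_sectionsOf [FiniteDimensional ℝ V₁] [FiniteDimensional ℝ V₂] (hm : m ≠ 0)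
    {ρ₁ : GLin m →* (V₁ →L[ℝ] V₁)} {ρ₂ : GLin m →* (V₂ →L[ℝ] V₂)} {c₁ c₂ : ℝ} {k : ℕ}
    {β : LinearMap.BilinForm ℝ (SymTensors m V₁ V₂ k)}
    (h : IsContravariantRep (glAction (symbolRep ρ₁ ρ₂ k)) (k - c₁ + c₂) β)
    {ι : Type*} [Fintype ι] [DecidableEq ι] (b : Module.Basis ι ℝ (sl (Fin m ⊕ Unit) ℝ))
    {I : Submodule ℝ (SymTensors m V₁ V₂ k)} (hI : IsSlIrreducible (symbolRep ρ₁ ρ₂ k) I) :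
    ∃ μ : Module.Dual ℂ (cartan m), (∀ ν, IsHighestWeight (symbolRep ρ₁ ρ₂ k) I ν ↔ ν = μ) ∧
      ∃ α : ℝ, (α : ℂ) = casimirEigenvalue m k ((c₁ - c₂) / m) μ ∧
        ∀ T ∈ sectionsOf k I, casimir ρ₁ ρ₂ b T = α • T := by
  have hgl := (isSlIrreducible_iff hm h I).1 hI
  obtain ⟨w, hwsum, hw⟩ := exists_weights h hgl
  have hm' : (m : ℝ) ≠ 0 := Nat.cast_ne_zero.2 hm
  refine ⟨weightOf fun i => (w i : ℂ), isHighestWeight_iff h hgl hw, _,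
    (casimirEigenvalue_weightOf hm k ((c₁ - c₂) / m) w ?_).symm, ?_⟩
  -- With δ = (c₁ - c₂)/m the sum of the weights k - c₁ + c₂ is k - mδ.
  · rw [hwsum]
    field_simp
    ring
  · intro S hS
    obtain ⟨T, hT, rfl⟩ := mem_sectionsOf.1 hS
    rw [casimir_inclDeg, ← map_smul]
    congr 1
    refine Subtype.ext (funext fun x => ?_)
    rw [casimirDeg_apply, h.glCasimir_apply hgl hw (hT x), sum_weights_eq]
    have h1 : ∀ v, diffRep (symbolRep ρ₁ ρ₂ k) 1 v = ((k : ℝ) - c₁ + c₂) • v := fun v => by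
      have h2 := LinearMap.congr_fun h.one v
      rw [glAction_apply, ofMatrix_one] at h2
      exact h2
    rw [h1, h1, hwsum, smul_smul, smul_smul, ← add_smul, ← add_smul, smul_smul, ← sq]
    rfl

end Decomposition

end ProjectiveSymbols

end
-- The spectral decomposition of the space of symbols
open ProjectiveSymbols in
theorem mainTheorem3 (m : ℕ) (hm : 2 ≤ m) (Y₁ Y₂ : YoungDiagram)
    (hY₁ : Y₁.colLen 0 < m) (hY₂ : Y₂.colLen 0 < m) (lam₁ lam₂ : ℝ) (z₁ z₂ : ℤ)
    (ρ₁ : GLin m →* (YoungSpace m Y₁ →L[ℝ] YoungSpace m Y₁)) (hρ₁ : ρ₁ = youngRep m Y₁ lam₁ z₁)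
    (ρ₂ : GLin m →* (YoungSpace m Y₂ →L[ℝ] YoungSpace m Y₂)) (hρ₂ : ρ₂ = youngRep m Y₂ lam₂ z₂)
    {ι : Type*} [Fintype ι] [DecidableEq ι]
    (b : Module.Basis ι ℝ (LieAlgebra.SpecialLinear.sl (Fin m ⊕ Unit) ℝ)) :
    -- the space of symbols is the direct sum of the eigenspaces of `C`
    DirectSum.IsInternal (fun α : ℝ => Module.End.eigenspace (casimir ρ₁ ρ₂ b) α) ∧
    -- each `S^k ℝ^m ⊗ V₁^* ⊗ V₂` is a direct sum of irreducible representations of `sl(m, ℝ)`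
    (∀ k, ∃ (n : ℕ) (I : Fin n → Submodule ℝ (SymTensors m (YoungSpace m Y₁) (YoungSpace m Y₂) k)),
      IsSlDecomposition (symbolRep ρ₁ ρ₂ k) I) ∧
    -- `a₁` and `a₂` are the unique numbers with `ρ_*(Id) = a_i Id` on `V_i`
    ∃ a₁ a₂ : ℝ,
      (∀ c : ℝ, diffRep ρ₁ 1 = c • 1 ↔ c = a₁) ∧ (∀ c : ℝ, diffRep ρ₂ 1 = c • 1 ↔ c = a₂) ∧
      ∀ (n : ℕ → ℕ)
        (I : ∀ k, Fin (n k) → Submodule ℝ (SymTensors m (YoungSpace m Y₁) (YoungSpace m Y₂) k)),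
        (∀ k, IsSlDecomposition (symbolRep ρ₁ ρ₂ k) (I k)) →
          -- the space of symbols is the direct sum of the spaces `E_{k,s}`
          DirectSum.IsInternal (fun p : Σ k, Fin (n k) => sectionsOf p.1 (I p.1 p.2)) ∧
          ∀ (k : ℕ) (s : Fin (n k)), ∃ μ : Module.Dual ℂ (cartan m),
            -- `μ` is the highest weight of `I_{k,s}`, and `C` acts on `E_{k,s}` by `α_{k,s}`
            (∀ ν, IsHighestWeight (symbolRep ρ₁ ρ₂ k) (I k s) ν ↔ ν = μ) ∧
            ∃ α : ℝ, (α : ℂ) = casimirEigenvalue m k ((a₁ - a₂) / m) μ ∧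
              ∀ T ∈ sectionsOf k (I k s), casimir ρ₁ ρ₂ b T = α • T := by
  have hm0 : m ≠ 0 := by omega
  obtain ⟨a₁, h₁⟩ := youngRep_contravariant m Y₁ lam₁ z₁
  obtain ⟨a₂, h₂⟩ := youngRep_contravariant m Y₂ lam₂ z₂
  rw [← hρ₁] at h₁
  rw [← hρ₂] at h₂
  -- On a nonzero space the identity operator is nonzero, so a scalar is determined by the operator
  -- it defines; this is the uniqueness of a₁ and a₂.
  have := youngSpace_nontrivial hY₁.le
  have := youngSpace_nontrivial hY₂.le
  have hrep : ∀ k, ∃ β, IsContravariantRep (glAction (symbolRep ρ₁ ρ₂ k)) (k - a₁ + a₂) β :=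
    fun k => (symbolRep_contravariant h₁ h₂ k).imp fun β hβ => hβ.isContravariantRep
  choose β hβ using hrep
  have hdec : ∀ k, ∃ (n : ℕ) (I : Fin n → Submodule ℝ
      (SymTensors m (YoungSpace m Y₁) (YoungSpace m Y₂) k)),
      IsSlDecomposition (symbolRep ρ₁ ρ₂ k) I := by
    intro k
    obtain ⟨n, I, hI, hirr⟩ := (hβ k).exists_isInternal_irreducible
    exact ⟨n, I, hI, fun s => (isSlIrreducible_iff hm0 (hβ k) _).2 (hirr s)⟩
  refine ⟨?_, hdec, a₁, a₂, fun c => ?_, fun c => ?_, fun n I hI =>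
    ⟨isInternal_sectionsOf fun k => (hI k).1,
      fun k s => casimir_sectionsOf hm0 (hβ k) b ((hI k).2 s)⟩⟩
  · choose n I hI using hdec
    rw [DirectSum.isInternal_submodule_iff_iSupIndep_and_iSup_eq_top]
    -- Eigenspaces are always independent; they span because each space of sections of one chosen
    -- decomposition lies in a single eigenspace.
    refine ⟨Module.End.eigenspaces_iSupIndep _, ?_⟩
    rw [eq_top_iff, ← (isInternal_sectionsOf fun k => (hI k).1).submodule_iSup_eq_top]
    refine iSup_le fun p => ?_
    obtain ⟨μ, -, α, -, hα⟩ := casimir_sectionsOf hm0 (hβ p.1) b ((hI p.1).2 p.2)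
    exact le_trans (fun T hT => Module.End.mem_eigenspace_iff.2 (hα T hT))
      (le_iSup (fun α : ℝ => Module.End.eigenspace (casimir ρ₁ ρ₂ b) α) α)
  · rw [h₁.diffRep_one]
    exact ⟨fun h => (smul_left_injective ℝ one_ne_zero h).symm, fun h => by rw [h]⟩
  · rw [h₂.diffRep_one]
    exact ⟨fun h => (smul_left_injective ℝ one_ne_zero h).symm, fun h => by rw [h]⟩
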